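/- **Setting.** Let $D\in\{3,4\}$, let $\Lambda=\{-L,\dots,L\}^D\subset\mathbb Z^D$, and let $c^\dagger_{x,\sigma},c_{x,\sigma}$ ($x\in\Lambda$, $\sigma\in\{\uparrow,\downarrow\}$) be the electron creation and annihilation operators on the fermionic Fock space over $\Lambda$, with $n_{x,\sigma}=c^\dagger_{x,\sigma}c_{x,\sigma}$ and $N_\Lambda=\sum_{x\in\Lambda}\sum_\sigma n_{x,\sigma}$. A gauge field assigns to each bond $b$ (nearest-neighbour pair of sites) of $\Lambda$ an angle $A_b\in[-\pi,\pi]$, read as an antisymmetric function $A_{y,x}=-A_{x,y}$; open boundary conditions are imposed, that is, $A_{x,y}=0$ unless $x,y\in\Lambda$. The electron Hamiltonian is $$H_\Lambda(A)=\sum_{x,y\in\Lambda}\sum_{\sigma,\tau}t^{\sigma,\tau}_{x,y}e^{iA_{x,y}}c^\dagger_{x,\sigma}c_{y,\tau}+\sum_{I\ge1}\ \sum_{(x_1,\sigma_1),\dots,(x_I,\sigma_I)}W_{x_1,\sigma_1;\dots;x_I,\sigma_I}\,n_{x_1,\sigma_1}\cdots n_{x_I,\sigma_I},$$ where the $t^{\sigma,\tau}_{x,y}\in\mathbb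 C$ are bounded, vanish unless $x,y$ are nearest neighbours, and satisfy $t^{\tau,\sigma}_{y,x}=\overline{t^{\sigma,\tau}_{x,y}}$; the $W$ are real and bounded, and the interaction has finite range: $W$ vanishes if the number $I$ of factors exceeds some fixed number or if two of the sites are farther apart than some fixed distance. For $\mu\in\mathbb R$ and $\kappa,\alpha>0$ put $$\mathcal H_\Lambda(A)=H_\Lambda(A)-\mu N_\Lambda-\kappa\sum_p\cos B_p-\frac1\alpha\sum_{x\in\Lambda}\cos(d^*A)_x,\qquad (d^*A)_x=\sum_{i=1}^D\bigl(A_{x+e_i,x}-A_{x,x-e_i}\bigr),$$ where $p$ runs over the plaquettes (unit square cells) in $\Lambda$ and $B_p$ is the sum of $A$ around $p$. For $\beta>0$ let $$\langle X\rangle_\Lambda=\frac1{Z_\Lambda}\int_{[-\pi,\pi]^{\mathcal B}}\prod_{b\in\mathcal B}dA_b\ \mathrm{Tr}\bigl(X\,e^{-\beta\mathcal H_\Lambda(A)}\bigr),\qquad\langle1\rangle_\Lambda=1,$$ where $\mathcal B$ is the set of bonds of $\Lambda$. For $J>0$ and $s>0$ define $$f(s)=2\sup_{q>0}\Bigl\{q-2s\,\frac{\cosh(qJ)-1}{J^2}\Bigr\}.$$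 **Theorem 1.** For $D=3$ and for $D=4$ there are constants $J>0$ and $c_D>0$, which depend only on $D$, such that the following holds. First, $f(s)\sim\frac1{2s}$ as $s\to\infty$, that is, $2s\,f(s)\to1$; so $f(\beta/\alpha)$ is of the order $\alpha/\beta$ for large $\beta/\alpha$. Second, for all $\alpha,\beta>0$ and all $r$ there is a constant $\mathrm{Const}$, which depends only on $D,\alpha,\beta,r$, such that for all $t$, $W$, $\mu$, $\kappa$ as above and all sites $u,v\in\mathbb Z^D$ with $|u-v|\le r$ (Euclidean norm), and $u\ne0$ if $D=4$, the infinite-volume Cooper-pair two-point function satisfies $$\bigl|\langle c^\dagger_{u\uparrow}c^\dagger_{v\downarrow}c_{-v\downarrow}c_{-u\uparrow}\rangle\bigr|\le\mathrm{Const}\cdot\begin{cases}\exp\bigl[-c_3\,f(\beta/\alpha)\,|u|\bigr],&D=3,\\ \exp\bigl[-c_4\,f(\beta/\alpha)\,\log|u|\bigr],&D=4.\end{cases}$$ Here the infinite-volume two-point function is $\lim_{L\to\infty}\langle c^\dagger_{u\uparrow}c^\dagger_{v\downarrow}c_{-v\downarrow}c_{-u\uparrow}\rangle_\Lambda$; the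 bound holds for every limit point as $L\to\infty$, hence for the limit whenever it exists. -/

import Mathlib

open Filter Topology MeasureTheory Asymptotics
open scoped Matrix

noncomputable section

namespace GaugedElectrons

/-! ### The lattice -/

/-- Sites of the hypercubic lattice `ℤ^D`. -/
abbrev Site (D : ℕ) : Type := Fin D → ℤ

/-- Electron spin; `up` and `down` are the two values. -/
abbrev Spin : Type := Fin 2

abbrev up : Spin := 0

abbrev down : Spin := 1

/-- The unit vector in the `i`-th direction. -/
def unitVec {D : ℕ} (i : Fin D) : Site D := Pi.single i 1

/-- The Euclidean length of a lattice vector. -/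
def siteNorm {D : ℕ} (x : Site D) : ℝ := √(∑ i, (x i : ℝ) ^ 2)

/-- Two sites are nearest neighbours if they differ by a unit vector. -/
def NearestNeighbor {D : ℕ} (x y : Site D) : Prop :=
  ∃ i, y = x + unitVec i ∨ x = y + unitVec i

/-- The box `Λ = {-L, …, L}^D`. -/
def box (D L : ℕ) : Finset (Site D) :=
  Fintype.piFinset fun _ => Finset.Icc (-(L : ℤ)) (L : ℤ)

/-! ### Fermions on the box -/

/-- The one-electron states (site and spin) in the box. -/
def modes (D L : ℕ) : Finset (Site D × Spin) := box D L ×ˢ Finset.univ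

/-- Occupation-number configurations: sets of occupied one-electron states in the box. They index
an orthonormal basis of the fermionic Fock space over the box. -/
abbrev Config (D L : ℕ) : Type := ↥(modes D L).powerset

/-- Operators on the (finite-dimensional) Fock space over the box. -/
abbrev FockOp (D L : ℕ) : Type := Matrix (Config D L) (Config D L) ℂ

/-- The lexicographic order of one-electron states, which fixes the fermionic signs. -/
def Before {D : ℕ} (m n : Site D × Spin) : Prop :=
  toLex (toLex m.1, m.2) < toLex (toLex n.1, n.2)

open Classical in
/-- The fermionic sign: `-1` to the number of occupied states that precede `m`. -/
def fermiSign {D : ℕ} (S : Finset (Site D × Spin)) (m : Site D × Spin) : ℂ :=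
  (-1) ^ (S.filter fun n => Before n m).card

/-- The annihilation operator `c_m`: it maps the basis vector `|T⟩` to `± |T \ {m}⟩` if `m ∈ T`,
and to `0` otherwise (in particular it is `0` if the site of `m` is not in the box). -/
def ann {D : ℕ} (L : ℕ) (m : Site D × Spin) : FockOp D L :=
  Matrix.of fun S T => if m ∈ T.1 ∧ S.1 = T.1.erase m then fermiSign T.1 m else 0

/-- The creation operator `c_m†`. -/
def cre {D : ℕ} (L : ℕ) (m : Site D × Spin) : FockOp D L := (ann L m)ᴴ

/-- The number operator `n_m = c_m† c_m`. -/
def num {D : ℕ} (L : ℕ) (m : Site D × Spin) : FockOp D L := cre L m * ann L m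

/-- The total electron number `N_Λ`. -/
def totalNumber (D L : ℕ) : FockOp D L := ∑ m ∈ modes D L, num L m

/-! ### The gauge field -/

/-- Bonds of the box: `(x, i)` stands for the bond from `x` to `x + e_i`; both ends are in the
box (open boundary conditions). -/
abbrev Bond (D L : ℕ) : Type :=
  {b : Site D × Fin D // b.1 ∈ box D L ∧ b.1 + unitVec b.2 ∈ box D L}

/-- The bonds of the box, as a subset of the finite set of pairs of a site and a direction. -/
instance (D L : ℕ) : Finite (Bond D L) :=
  Set.Finite.to_subtype
    (((box D L ×ˢ (Finset.univ : Finset (Fin D))).finite_toSet).subset fun b hb => by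
      simpa using hb.1)

instance (D L : ℕ) : Fintype (Bond D L) := Fintype.ofFinite _

open Classical in
/-- The value of the gauge field on the bond from `x` to `x + e_i`, set to `0` if this is not a
bond of the box. -/
def extField {D L : ℕ} (A : Bond D L → ℝ) (x : Site D) (i : Fin D) : ℝ :=
  if h : x ∈ box D L ∧ x + unitVec i ∈ box D L then A ⟨(x, i), h⟩ else 0

/-- The antisymmetric gauge field `A_{x,y}`: it is `A_b` if `b` is the bond from `x` to
`y = x + e_i`, it is `-A_b` if `b` is the bond from `y` to `x = y + e_i`, and `0` if `x, y` are
not the ends of a bond of the box. -/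
def gauge {D L : ℕ} (A : Bond D L → ℝ) (x y : Site D) : ℝ :=
  ∑ i, ((if y = x + unitVec i then extField A x i else 0)
    - (if x = y + unitVec i then extField A y i else 0))

/-- The divergence `(d* A)_x = ∑_i (A_{x+e_i,x} - A_{x,x-e_i})`. -/
def divergence {D L : ℕ} (A : Bond D L → ℝ) (x : Site D) : ℝ :=
  ∑ i, (gauge A (x + unitVec i) x - gauge A x (x - unitVec i))

/-- The flux `B_p` through the plaquette with corners `x`, `x + e_i`, `x + e_i + e_j`,
`x + e_j`. -/
def flux {D L : ℕ} (A : Bond D L → ℝ) (x : Site D) (i j : Fin D) : ℝ :=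
  gauge A x (x + unitVec i) + gauge A (x + unitVec i) (x + unitVec i + unitVec j)
    + gauge A (x + unitVec i + unitVec j) (x + unitVec j) + gauge A (x + unitVec j) x

/-- The plaquettes of the box, given by a corner `x` and directions `i < j`; all four corners
lie in the box. -/
def plaquettes (D L : ℕ) : Finset (Site D × Fin D × Fin D) :=
  (box D L ×ˢ Finset.univ ×ˢ Finset.univ).filter fun p =>
    p.2.1 < p.2.2 ∧ p.1 + unitVec p.2.1 ∈ box D L ∧ p.1 + unitVec p.2.2 ∈ box D L ∧
      p.1 + unitVec p.2.1 + unitVec p.2.2 ∈ box D L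

/-! ### The model -/

/-- The parameters of the electron Hamiltonian on `ℤ^D`: bounded Hermitian nearest-neighbour
hopping amplitudes, and bounded real density interactions of finite range. The amplitude of
`n_{p 0} n_{p 1} ⋯ n_{p (I-1)}` is `W I p`; repetitions among the one-electron states `p j` are
allowed. -/
structure ElectronModel (D : ℕ) where
  /-- hopping amplitudes -/
  t : Site D → Site D → Spin → Spin → ℂ
  t_herm : ∀ x y σ τ, t y x τ σ = star (t x y σ τ)
  t_nearest : ∀ x y σ τ, ¬ NearestNeighbor x y → t x y σ τ = 0
  t_bounded : ∃ t₀ : ℝ, ∀ x y σ τ, ‖t x y σ τ‖ ≤ t₀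
  /-- interaction strengths -/
  W : (I : ℕ) → (Fin I → Site D × Spin) → ℝ
  W_bounded : ∃ W₀ : ℝ, ∀ I p, |W I p| ≤ W₀
  /-- the largest number of density factors in an interaction term -/
  maxBody : ℕ
  W_maxBody : ∀ I p, maxBody < I → W I p = 0
  W_range : ∃ R : ℝ, ∀ I p, W I p ≠ 0 → ∀ i j, siteNorm ((p i).1 - (p j).1) ≤ R

variable {D : ℕ}

/-- The hopping part of the electron Hamiltonian in the gauge field `A`. -/
def hopping (M : ElectronModel D) (L : ℕ) (A : Bond D L → ℝ) : FockOp D L :=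
  ∑ x ∈ box D L, ∑ y ∈ box D L, ∑ σ : Spin, ∑ τ : Spin,
    (M.t x y σ τ * Complex.exp (Complex.I * (gauge A x y : ℂ))) • (cre L (x, σ) * ann L (y, τ))

/-- The interaction part of the electron Hamiltonian. -/
def interaction (M : ElectronModel D) (L : ℕ) : FockOp D L :=
  ∑ I ∈ Finset.Icc 1 M.maxBody, ∑ p ∈ Fintype.piFinset fun _ : Fin I => modes D L,
    (M.W I p : ℂ) • (List.ofFn fun j => num L (p j)).prod

/-- The energy of the gauge field, with the gauge-fixing term. -/
def gaugeEnergy (L : ℕ) (κ α : ℝ) (A : Bond D L → ℝ) : ℝ :=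
  -κ * ∑ p ∈ plaquettes D L, Real.cos (flux A p.1 p.2.1 p.2.2)
    - 1 / α * ∑ x ∈ box D L, Real.cos (divergence A x)

/-- The total energy `ℋ_Λ(A)`. -/
def energy (M : ElectronModel D) (L : ℕ) (μ κ α : ℝ) (A : Bond D L → ℝ) : FockOp D L :=
  hopping M L A + interaction M L - (μ : ℂ) • totalNumber D L
    + (gaugeEnergy L κ α A : ℂ) • (1 : FockOp D L)

/-- `∫ ∏_b dA_b Tr (X exp(-β ℋ_Λ(A)))`, with each `A_b` in `[-π, π]`. -/
def weight (M : ElectronModel D) (L : ℕ) (β μ κ α : ℝ) (X : FockOp D L) : ℂ :=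
  ∫ A in Set.Icc (fun _ : Bond D L => -Real.pi) (fun _ => Real.pi),
    (X * NormedSpace.exp (-(β : ℂ) • energy M L μ κ α A)).trace

/-- The thermal expectation value in the box at inverse temperature `β`; the denominator is the
partition function. -/
def expectation (M : ElectronModel D) (L : ℕ) (β μ κ α : ℝ) (X : FockOp D L) : ℂ :=
  weight M L β μ κ α X / weight M L β μ κ α 1

/-- The Cooper-pair two-point function `⟨c†_{u↑} c†_{v↓} c_{-v↓} c_{-u↑}⟩` in the box. -/
def cooperCorrelation (M : ElectronModel D) (L : ℕ) (β μ κ α : ℝ) (u v : Site D) : ℂ :=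
  expectation M L β μ κ α (cre L (u, up) * cre L (v, down) * ann L (-v, down) * ann L (-u, up))

/-! ### The decay rate -/

/-- `f(s) = 2 sup_{q > 0} (q - 2 s (cosh (q J) - 1) / J²)`. -/
def decayRate (J s : ℝ) : ℝ :=
  2 * sSup ((fun q : ℝ => q - 2 * s * ((Real.cosh (q * J) - 1) / J ^ 2)) '' Set.Ioi 0)

/-- The supremum that defines `decayRate` is a supremum of a set that is bounded above. -/
theorem decayRate_bddAbove {J s : ℝ} (hJ : 0 < J) (hs : 0 < s) :
    BddAbove ((fun q : ℝ => q - 2 * s * ((Real.cosh (q * J) - 1) / J ^ 2)) '' Set.Ioi 0) := by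
  refine ⟨1 / (4 * s), ?_⟩
  rintro _ ⟨q, hq, rfl⟩
  have h1 : q ^ 2 / 2 ≤ (Real.cosh (q * J) - 1) / J ^ 2 := by
    rw [le_div_iff₀ (by positivity)]
    have e : Real.cosh (q * J) = 1 + 2 * Real.sinh (q * J / 2) ^ 2 := by
      have a := Real.cosh_two_mul (q * J / 2)
      have b := Real.cosh_sq (q * J / 2)
      rw [show 2 * (q * J / 2) = q * J by ring] at a
      linarith
    have hp : 0 < q * J / 2 := by have : 0 < q := hq; positivity
    have := pow_le_pow_left₀ hp.le (Real.self_le_sinh_iff.2 hp.le) 2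
    nlinarith
  have h2 : 2 * s * (q ^ 2 / 2) ≤ 2 * s * ((Real.cosh (q * J) - 1) / J ^ 2) := by gcongr
  have h3 : q - s * q ^ 2 ≤ 1 / (4 * s) := by
    rw [le_div_iff₀ (by positivity)]
    nlinarith [sq_nonneg (2 * s * q - 1)]
  show q - 2 * s * ((Real.cosh (q * J) - 1) / J ^ 2) ≤ 1 / (4 * s)
  linarith

end GaugedElectrons

end

open GaugedElectrons

/-! The proof is the McBryan–Spencer method of complex translations, applied to gauge
transformations. Shifting `A` by the lattice gradient of `τθ` preserves every flux and acts on the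
electrons by conjugation with a diagonal unitary, so the trace with the Cooper-pair operator only
gains the phase `exp(iτΘ)`, where `Θ = pairCharge θ u v`. The gauge-fixing term alone feels the
shift: its divergence moves by `-τ Δθ` once `θ` is supported inside the box. By translation
invariance on the torus, the integral with these two modifications is independent of real `τ`; being
entire, it is independent of complex `τ` (`weight_pairOp_eq`). At `τ = iq` the phase becomes the
gain `exp(-qΘ)`, paid for by `exp(β/α ∑ (cosh(q Δθ) - 1))` (`norm_cooperCorrelation_le`). Hopping,
interaction, `μ` and `κ` drop out, because a trace against a positive Boltzmann operator is at most
the operator norm times the partition function.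

What remains is potential theory for the bi-Laplacian. If `|Δθ| ≤ J`, the cosh cost is at most `∑
(Δθ)²` times `(cosh(qJ) - 1)/J²` (`cosh_mul_sub_one_le`). A unit bump of radius `R` has energy `∑
(Δθ)²` of order `R^(D-4)`. For `D = 3` a bump of radius `|u|` and height proportional to `|u|`,
centred at `u`, has charge and energy of order `|u|`. For `D = 4` the energy is scale invariant, and
about `log |u|` almost orthogonal dyadic bumps are superposed. With charge `2cg` and energy `4cg` up
to constants, the exponent is `-2cg (q - 2s (cosh(qJ) - 1)/J²)`, `s = β/α`; the best `q` turns this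
into `-c f(s) g` (`exists_bound_of_hasTestFunctions`). -/

noncomputable section

namespace GaugedElectrons

/-! ### Integration of periodic functions -/

/-- The integral of a periodic function over the torus is translation invariant. -/
theorem setIntegral_add_eq_of_periodic {ι : Type*} [Fintype ι] (g : (ι → ℝ) → ℂ)
    (hg : Continuous g) (hper : ∀ (A : ι → ℝ) (n : ι → ℤ),
      g (A + fun b => (n b : ℝ) * (2 * Real.pi)) = g A) (h : ι → ℝ) :
    ∫ A in Set.Icc (fun _ : ι => -Real.pi) (fun _ => Real.pi), g (A + h) =
      ∫ A in Set.Icc (fun _ : ι => -Real.pi) (fun _ => Real.pi), g A := by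
  have : Fact (0 < 2 * Real.pi) := ⟨by positivity⟩
  have e : Set.Icc (fun _ : ι => -Real.pi) (fun _ => Real.pi) =ᵐ[volume]
      Set.univ.pi fun _ : ι => Set.Ioc (-Real.pi) (-Real.pi + 2 * Real.pi) := by
    rw [show -Real.pi + 2 * Real.pi = Real.pi by ring]
    exact (Measure.univ_pi_Ioc_ae_eq_Icc (μ := fun _ : ι => (volume : Measure ℝ))
      (f := fun _ => -Real.pi) (g := fun _ => Real.pi)).symm
  rw [setIntegral_congr_set e, setIntegral_congr_set e]
  have hq := measurePreserving_pi _ _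
    (fun _ : ι => AddCircle.measurePreserving_mk (2 * Real.pi) (-Real.pi))
  rw [← Measure.restrict_pi_pi, ← volume_pi, ← volume_pi] at hq
  set q : (ι → ℝ) → ι → AddCircle (2 * Real.pi) := fun A b => (A b : AddCircle (2 * Real.pi))
  -- `g` descends to the torus through representatives in `(-π, π]`; measurability of `G` is enough,
  -- and Haar measure there is translation invariant.
  set G : (ι → AddCircle (2 * Real.pi)) → ℂ := fun z =>
    g fun b => (AddCircle.measurableEquivIoc (2 * Real.pi) (-Real.pi) (z b) : ℝ) with hG
  have hGm : Measurable G := hg.measurable.comp <| measurable_pi_lambda _ fun b =>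
    measurable_subtype_coe.comp
      ((AddCircle.measurableEquivIoc _ _).measurable.comp (measurable_pi_apply b))
  have hGq : ∀ A, G (q A) = g A := by
    intro A
    have : ∀ b, ∃ n : ℤ, (AddCircle.measurableEquivIoc (2 * Real.pi) (-Real.pi) (q A b) : ℝ) =
        A b + n * (2 * Real.pi) := by
      intro b
      have h1 : (((AddCircle.measurableEquivIoc (2 * Real.pi) (-Real.pi) (q A b) : ℝ)) :
          AddCircle (2 * Real.pi)) = (A b : AddCircle (2 * Real.pi)) :=
        (AddCircle.equivIoc (2 * Real.pi) (-Real.pi)).symm_apply_apply _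
      rw [← sub_eq_zero, ← AddCircle.coe_sub, AddCircle.coe_eq_zero_iff] at h1
      obtain ⟨n, hn⟩ := h1
      rw [zsmul_eq_mul] at hn
      exact ⟨n, by linarith⟩
    choose n hn using this
    rw [hG]
    simp only [hn]
    exact hper A n
  have key : ∀ k : (ι → AddCircle (2 * Real.pi)) → ℂ, Measurable k →
      ∫ A in Set.univ.pi fun _ : ι => Set.Ioc (-Real.pi) (-Real.pi + 2 * Real.pi), k (q A) =
        ∫ z, k z := by
    intro k hk
    rw [← hq.map_eq, integral_map hq.measurable.aemeasurable hk.aestronglyMeasurable]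
  calc _ = ∫ A in Set.univ.pi fun _ : ι => Set.Ioc (-Real.pi) (-Real.pi + 2 * Real.pi),
        (fun z => G (z + q h)) (q A) := by
        refine integral_congr_ae (Eventually.of_forall fun A => ?_)
        exact (hGq (A + h)).symm
    _ = ∫ z, G (z + q h) := key _ (hGm.comp (measurable_id.add_const _))
    _ = ∫ z, G z := integral_add_right_eq_self _ _
    _ = _ := by rw [← key G hGm]; simp only [hGq]

/-- An integral over a compact set of entire functions is entire. -/
theorem differentiable_setIntegral {ι : Type*} [Fintype ι] {K : Set (ι → ℝ)} (hK : IsCompact K)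
    {Φ Φ' : ℂ → (ι → ℝ) → ℂ} (h1 : Continuous Φ.uncurry) (h2 : Continuous Φ'.uncurry)
    (hd : ∀ τ A, HasDerivAt (fun τ => Φ τ A) (Φ' τ A) τ) :
    Differentiable ℂ fun τ => ∫ A in K, Φ τ A := by
  intro τ
  have h1' : ∀ τ, Continuous (Φ τ) := fun τ => h1.comp (by fun_prop : Continuous fun A => (τ, A))
  have h2' : ∀ τ, Continuous (Φ' τ) := fun τ => h2.comp (by fun_prop : Continuous fun A => (τ, A))
  obtain ⟨C, hC⟩ := (((isCompact_closedBall τ 1).prod hK).bddAbove_image h2.norm.continuousOn)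
  refine (hasDerivAt_integral_of_dominated_loc_of_deriv_le (s := Metric.closedBall τ 1)
    (bound := fun _ => C) (F' := Φ') (Metric.closedBall_mem_nhds τ one_pos)
    (Eventually.of_forall fun τ => (h1' τ).aestronglyMeasurable)
    ((h1' τ).continuousOn.integrableOn_compact hK) (h2' τ).aestronglyMeasurable ?_
    (integrableOn_const hK.measure_lt_top.ne) ?_).2.differentiableAt
  · filter_upwards [ae_restrict_mem hK.measurableSet] with A hA x hx
    exact hC ⟨(x, A), ⟨hx, hA⟩, rfl⟩
  · exact Eventually.of_forall fun A x _ => hd x A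

/-- An entire function that is constant on the real line is constant. -/
theorem eq_of_forall_real_eq {F : ℂ → ℂ} (hF : Differentiable ℂ F)
    (h : ∀ x : ℝ, F x = F 0) (z : ℂ) : F z = F 0 := by
  have h1 : AnalyticOnNhd ℂ F Set.univ := fun z _ => hF.analyticAt z
  have h2 : AnalyticOnNhd ℂ (fun _ : ℂ => F 0) Set.univ :=
    fun z _ => analyticAt_const
  -- The real points accumulate at `0`, so the identity theorem applies.
  have hfr : ∃ᶠ z in 𝓝[≠] (0 : ℂ), F z = F 0 := by
    have ht : Tendsto (fun x : ℝ => (x : ℂ)) (𝓝[≠] 0) (𝓝[≠] 0) := by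
      refine tendsto_nhdsWithin_iff.2 ⟨?_, ?_⟩
      · exact (Complex.continuous_ofReal.tendsto' 0 0 (by simp)).mono_left nhdsWithin_le_nhds
      · filter_upwards [self_mem_nhdsWithin] with x hx
        simpa using hx
    exact ht.frequently (Eventually.of_forall h).frequently
  exact congrFun (h1.eq_of_frequently_eq h2 hfr) z

/-! ### Hyperbolic functions -/

theorem sinh_mul_le {l a : ℝ} (hl : 0 ≤ l) (hl1 : l ≤ 1) (ha : 0 ≤ a) :
    Real.sinh (l * a) ≤ l * Real.sinh a := by
  have hmono : MonotoneOn (fun x => l * Real.sinh x - Real.sinh (l * x)) (Set.Ici 0) := by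
    refine monotoneOn_of_deriv_nonneg (convex_Ici 0) (by fun_prop) (by fun_prop) ?_
    intro x hx
    rw [interior_Ici] at hx
    have hd : HasDerivAt (fun x => l * Real.sinh x - Real.sinh (l * x))
        (l * Real.cosh x - Real.cosh (l * x) * (l * 1)) x :=
      ((Real.hasDerivAt_sinh x).const_mul l).sub
        (((hasDerivAt_id x).const_mul l).sinh)
    rw [hd.deriv]
    have : Real.cosh (l * x) ≤ Real.cosh x := by
      rw [Real.cosh_le_cosh, abs_mul, abs_of_nonneg hl]
      nlinarith [abs_nonneg x]
    nlinarith
  have := hmono (Set.self_mem_Ici) (Set.mem_Ici.2 ha) ha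
  simp at this
  linarith

theorem cosh_sub_one_eq (x : ℝ) : Real.cosh x - 1 = 2 * Real.sinh (x / 2) ^ 2 := by
  have a := Real.cosh_two_mul (x / 2)
  have b := Real.cosh_sq (x / 2)
  rw [show 2 * (x / 2) = x by ring] at a
  linarith

/-- By `cosh x - 1 = 2 sinh²(x/2)` and convexity of `sinh` on the half-line, `(cosh(qρ) - 1)/ρ²`
increases with `|ρ|`. This replaces the cosh cost by a quadratic energy, with exactly the factor
that occurs in `decayRate`. -/
theorem cosh_mul_sub_one_le {q ρ J : ℝ} (hq : 0 ≤ q) (hJ : 0 < J) (hρ : |ρ| ≤ J) :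
    Real.cosh (q * ρ) - 1 ≤ ρ ^ 2 * ((Real.cosh (q * J) - 1) / J ^ 2) := by
  have h1 : Real.cosh (q * ρ) = Real.cosh (q * |ρ|) := by
    rw [← Real.cosh_abs, abs_mul, abs_of_nonneg hq]
  have h2 := sinh_mul_le (l := |ρ| / J) (a := q * J / 2) (by positivity)
    ((div_le_one hJ).2 hρ) (by positivity)
  rw [show |ρ| / J * (q * J / 2) = q * |ρ| / 2 by field_simp] at h2
  rw [h1, cosh_sub_one_eq, cosh_sub_one_eq, ← sq_abs ρ]
  have h3 : 0 ≤ Real.sinh (q * |ρ| / 2) := Real.sinh_nonneg_iff.2 (by positivity)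
  calc 2 * Real.sinh (q * |ρ| / 2) ^ 2 ≤ 2 * (|ρ| / J * Real.sinh (q * J / 2)) ^ 2 := by gcongr
    _ = _ := by field_simp

/-! ### Lattice gauge fields -/

section Gauge

variable {D L : ℕ}

theorem unitVec_injective : Function.Injective (unitVec : Fin D → Site D) := by
  intro i j h
  by_contra hij
  have := congrFun h i
  simp [unitVec, hij] at this

theorem unitVec_add_ne_zero (i j : Fin D) : (unitVec i + unitVec j : Site D) ≠ 0 := by
  intro h
  have := congrFun h i
  by_cases hij : i = j
  · subst hij; simp [unitVec] at this
  · simp [unitVec, hij] at this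

theorem extField_add (A B : Bond D L → ℝ) (x : Site D) (i : Fin D) :
    extField (A + B) x i = extField A x i + extField B x i := by
  unfold extField; split_ifs <;> simp

theorem extField_smul (τ : ℝ) (A : Bond D L → ℝ) (x : Site D) (i : Fin D) :
    extField (τ • A) x i = τ * extField A x i := by
  unfold extField; split_ifs <;> simp

theorem continuous_extField (x : Site D) (i : Fin D) :
    Continuous fun A : Bond D L → ℝ => extField A x i := by
  unfold extField; split_ifs <;> fun_prop

theorem gauge_add (A B : Bond D L → ℝ) (x y : Site D) :
    gauge (A + B) x y = gauge A x y + gauge B x y := by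
  simp only [gauge, ← Finset.sum_add_distrib, extField_add]
  refine Finset.sum_congr rfl fun i _ => ?_
  split_ifs <;> ring

theorem gauge_smul (τ : ℝ) (A : Bond D L → ℝ) (x y : Site D) :
    gauge (τ • A) x y = τ * gauge A x y := by
  simp only [gauge, Finset.mul_sum, extField_smul]
  refine Finset.sum_congr rfl fun i _ => ?_
  split_ifs <;> ring

@[fun_prop]
theorem continuous_gauge (x y : Site D) : Continuous fun A : Bond D L → ℝ => gauge A x y := by
  refine continuous_finsetSum _ fun i _ => Continuous.sub ?_ ?_
  · split_ifs
    exacts [continuous_extField _ _, continuous_const]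
  · split_ifs
    exacts [continuous_extField _ _, continuous_const]

theorem gauge_swap (A : Bond D L → ℝ) (x y : Site D) : gauge A y x = -gauge A x y := by
  simp only [gauge, ← Finset.sum_neg_distrib, neg_sub]

theorem gauge_add_unitVec (A : Bond D L → ℝ) (x : Site D) (i : Fin D) :
    gauge A x (x + unitVec i) = extField A x i := by
  have h1 : ∀ j, (x + unitVec i = x + unitVec j) ↔ i = j := fun j =>
    ⟨fun h => unitVec_injective (add_left_cancel h), fun h => h ▸ rfl⟩
  have h2 : ∀ j, ¬ (x = x + unitVec i + unitVec j) := fun j h =>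
    unitVec_add_ne_zero i j (by rw [add_assoc] at h; exact (left_eq_add.1 h))
  simp [gauge, h1, h2]

theorem divergence_eq (A : Bond D L → ℝ) (x : Site D) :
    divergence A x = ∑ i, (extField A (x - unitVec i) i - extField A x i) := by
  refine Finset.sum_congr rfl fun i _ => ?_
  have h := gauge_add_unitVec A (x - unitVec i) i
  rw [sub_add_cancel] at h
  rw [gauge_swap, gauge_add_unitVec, gauge_swap, h]
  ring

theorem divergence_add (A B : Bond D L → ℝ) (x : Site D) :
    divergence (A + B) x = divergence A x + divergence B x := by
  simp only [divergence, gauge_add, ← Finset.sum_add_distrib]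
  exact Finset.sum_congr rfl fun i _ => by ring

theorem divergence_smul (τ : ℝ) (A : Bond D L → ℝ) (x : Site D) :
    divergence (τ • A) x = τ * divergence A x := by
  simp only [divergence, gauge_smul, Finset.mul_sum]
  exact Finset.sum_congr rfl fun i _ => by ring

@[fun_prop]
theorem continuous_divergence (x : Site D) :
    Continuous fun A : Bond D L → ℝ => divergence A x := by
  unfold divergence; fun_prop

theorem flux_add (A B : Bond D L → ℝ) (x : Site D) (i j : Fin D) :
    flux (A + B) x i j = flux A x i j + flux B x i j := by
  simp only [flux, gauge_add]; ring

@[fun_prop]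
theorem continuous_flux (x : Site D) (i j : Fin D) :
    Continuous fun A : Bond D L → ℝ => flux A x i j := by
  unfold flux; fun_prop

/-- Angles that are multiples of `2π`. -/
abbrev periods : AddSubgroup ℝ := AddSubgroup.zmultiples (2 * Real.pi)

theorem gauge_mem_periods {A : Bond D L → ℝ} (hA : ∀ b, A b ∈ periods) (x y : Site D) :
    gauge A x y ∈ periods := by
  have h : ∀ x i, extField A x i ∈ periods := by
    intro x i
    unfold extField
    split_ifs
    exacts [hA _, zero_mem _]
  refine sum_mem fun i _ => sub_mem ?_ ?_
  · split_ifs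
    exacts [h _ _, zero_mem _]
  · split_ifs
    exacts [h _ _, zero_mem _]

theorem flux_mem_periods {A : Bond D L → ℝ} (hA : ∀ b, A b ∈ periods) (x : Site D) (i j : Fin D) :
    flux A x i j ∈ periods :=
  add_mem (add_mem (add_mem (gauge_mem_periods hA _ _) (gauge_mem_periods hA _ _))
    (gauge_mem_periods hA _ _)) (gauge_mem_periods hA _ _)

theorem divergence_mem_periods {A : Bond D L → ℝ} (hA : ∀ b, A b ∈ periods) (x : Site D) :
    divergence A x ∈ periods :=
  sum_mem fun _ _ => sub_mem (gauge_mem_periods hA _ _) (gauge_mem_periods hA _ _)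

theorem cos_add_of_mem_periods {p : ℝ} (hp : p ∈ periods) (a : ℝ) :
    Real.cos (a + p) = Real.cos a := by
  obtain ⟨n, rfl⟩ := AddSubgroup.mem_zmultiples_iff.1 hp
  rw [zsmul_eq_mul, Real.cos_add_int_mul_two_pi]

theorem exp_I_mul_add_of_mem_periods {p : ℝ} (hp : p ∈ periods) (a : ℝ) :
    Complex.exp (Complex.I * ((a + p : ℝ) : ℂ)) = Complex.exp (Complex.I * (a : ℂ)) := by
  obtain ⟨n, rfl⟩ := AddSubgroup.mem_zmultiples_iff.1 hp
  have : Complex.I * ((a + n • (2 * Real.pi) : ℝ) : ℂ) =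
      Complex.I * (a : ℂ) + n * (2 * Real.pi * Complex.I) := by
    push_cast [zsmul_eq_mul]; ring
  rw [this, Complex.exp_periodic.int_mul n]

/-- The pure gauge field of a function on the sites. -/
def grad (L : ℕ) (φ : Site D → ℝ) : Bond D L → ℝ :=
  fun b => φ (b.1.1 + unitVec b.1.2) - φ b.1.1

theorem grad_smul (τ : ℝ) (φ : Site D → ℝ) : grad L (τ • φ) = τ • grad L φ := by
  funext b; simp [grad, mul_sub]

theorem gauge_grad (φ : Site D → ℝ) {x y : Site D} (hx : x ∈ box D L) (hy : y ∈ box D L)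
    (h : NearestNeighbor x y) : gauge (grad L φ) x y = φ y - φ x := by
  obtain ⟨i, rfl | rfl⟩ := h
  · rw [gauge_add_unitVec, extField, dif_pos ⟨hx, hy⟩]; rfl
  · rw [gauge_swap, gauge_add_unitVec, extField, dif_pos ⟨hy, hx⟩]
    simp [grad]

theorem flux_grad (φ : Site D → ℝ) {p : Site D × Fin D × Fin D} (hp : p ∈ plaquettes D L) :
    flux (grad L φ) p.1 p.2.1 p.2.2 = 0 := by
  obtain ⟨x, i, j⟩ := p
  simp only [plaquettes, Finset.mem_filter, Finset.mem_product] at hp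
  obtain ⟨⟨hx, -⟩, -, hi, hj, hij⟩ := hp
  rw [flux, gauge_grad φ hx hi ⟨i, Or.inl rfl⟩, gauge_grad φ hi hij ⟨j, Or.inl rfl⟩,
    gauge_grad φ hij hj ⟨i, Or.inr (add_right_comm _ _ _)⟩, gauge_grad φ hj hx ⟨j, Or.inr rfl⟩]
  ring

/-- The lattice Laplacian. -/
def laplacian (θ : Site D → ℝ) (x : Site D) : ℝ :=
  ∑ i, (θ (x + unitVec i) + θ (x - unitVec i) - 2 * θ x)

/-- The margin of one site puts all bonds touching the support of `θ` in the box; on any other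
missing bond the gradient is zero anyway. Hence open boundary conditions produce no boundary term in
the divergence. -/
theorem extField_grad {θ : Site D → ℝ} (hθ : ∀ x, θ x ≠ 0 → ∀ i, |x i| + 1 ≤ L) (x : Site D)
    (i : Fin D) : extField (grad L θ) x i = θ (x + unitVec i) - θ x := by
  unfold extField
  split_ifs with h
  · rfl
  · have hu : ∀ k, |(unitVec i : Site D) k| ≤ 1 := by
      intro k
      by_cases hk : k = i
      · subst hk; simp [unitVec]
      · simp [unitVec, hk]
    have mem : ∀ y : Site D, (∀ k, |y k| ≤ L) → y ∈ box D L := fun y hy =>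
      Fintype.mem_piFinset.2 fun k => Finset.mem_Icc.2 (abs_le.1 (hy k))
    have h0 : θ x = 0 := by
      by_contra h0
      refine h ⟨mem _ fun k => by linarith [hθ x h0 k], mem _ fun k => ?_⟩
      exact (abs_add_le _ _).trans (by linarith [hθ x h0 k, hu k])
    have h1 : θ (x + unitVec i) = 0 := by
      by_contra h1
      refine h ⟨mem _ fun k => ?_, mem _ fun k => by linarith [hθ _ h1 k]⟩
      have := abs_sub ((x + unitVec i) k) ((unitVec i : Site D) k)
      simp only [Pi.add_apply, add_sub_cancel_right] at this
      have h2 := hθ _ h1 k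
      simp only [Pi.add_apply] at h2
      linarith [hu k]
    rw [h0, h1, sub_zero]

theorem divergence_grad {θ : Site D → ℝ} (hθ : ∀ x, θ x ≠ 0 → ∀ i, |x i| + 1 ≤ L) (x : Site D) :
    divergence (grad L θ) x = -laplacian θ x := by
  rw [divergence_eq, laplacian, ← Finset.sum_neg_distrib]
  refine Finset.sum_congr rfl fun i _ => ?_
  rw [extField_grad hθ, extField_grad hθ, sub_add_cancel]
  ring

end Gauge

/-! ### Fermions and gauge transformations -/

section Fock

variable {D L : ℕ}

theorem num_eq_diagonal (m : Site D × Spin) :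
    num L m = Matrix.diagonal fun S : Config D L => if m ∈ S.1 then (1 : ℂ) else 0 := by
  ext S T
  rw [num, cre, Matrix.mul_apply]
  simp only [Matrix.conjTranspose_apply, ann, Matrix.of_apply]
  by_cases hT : m ∈ T.1
  · have hmem : T.1.erase m ∈ (modes D L).powerset :=
      Finset.mem_powerset.2 ((Finset.erase_subset _ _).trans (Finset.mem_powerset.1 T.2))
    rw [Finset.sum_eq_single (⟨T.1.erase m, hmem⟩ : Config D L)]
    · by_cases hST : S = T
      · subst hST
        simp only [hT, and_self, if_true, Matrix.diagonal_apply_eq]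
        simp only [fermiSign, star_pow, star_neg, star_one, ← mul_pow]
        simp
      · rw [Matrix.diagonal_apply_ne _ hST, if_neg, star_zero, zero_mul]
        rintro ⟨hS, h⟩
        refine hST (Subtype.ext ?_)
        rw [← Finset.insert_erase hS, ← Finset.insert_erase hT]
        exact congrArg _ h.symm
    · intro R _ hR
      have : ¬ (R.1 = T.1.erase m) := fun h => hR (Subtype.ext h)
      simp [this]
    · simp
  · by_cases hST : S = T
    · subst hST; simp [hT]
    · simp [hT, hST]

open scoped Matrix.Norms.L2Operator in
-- The C*-identity gives `‖c‖² = ‖c†c‖`, and `c†c` is diagonal with entries `0` and `1`.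
theorem norm_ann_le_one (m : Site D × Spin) : ‖ann L m‖ ≤ 1 := by
  have hdiag : (ann L m)ᴴ * ann L m = _ := num_eq_diagonal m
  have h1 := Matrix.l2_opNorm_conjTranspose_mul_self (ann L m)
  rw [hdiag, Matrix.l2_opNorm_diagonal] at h1
  have h2 : ‖fun S : Config D L => if m ∈ S.1 then (1 : ℂ) else 0‖ ≤ 1 := by
    refine (pi_norm_le_iff_of_nonneg zero_le_one).2 fun S => ?_
    split_ifs <;> simp
  nlinarith [norm_nonneg (ann L m)]

/-- The unitary operator that implements the gauge transformation `φ`. -/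
def gaugeUnitary (L : ℕ) (φ : Site D → ℝ) : FockOp D L :=
  Matrix.diagonal fun S => Complex.exp (Complex.I * ((∑ m ∈ S.1, φ m.1 : ℝ) : ℂ))

theorem gaugeUnitary_mul_neg (φ : Site D → ℝ) : gaugeUnitary L φ * gaugeUnitary L (-φ) = 1 := by
  rw [gaugeUnitary, gaugeUnitary, Matrix.diagonal_mul_diagonal, ← Matrix.diagonal_one]
  congr 1
  funext S
  rw [← Complex.exp_add]
  simp

theorem gaugeUnitary_neg_mul (φ : Site D → ℝ) : gaugeUnitary L (-φ) * gaugeUnitary L φ = 1 := by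
  simpa using gaugeUnitary_mul_neg (L := L) (-φ)

theorem gaugeUnitary_conjTranspose (φ : Site D → ℝ) :
    (gaugeUnitary L φ)ᴴ = gaugeUnitary L (-φ) := by
  rw [gaugeUnitary, gaugeUnitary, Matrix.diagonal_conjTranspose]
  congr 1
  funext S
  simp only [Pi.star_apply, RCLike.star_def, ← Complex.exp_conj]
  simp

/-- Removing a particle at `m.1` lowers the total phase of the configuration by `φ m.1`. -/
theorem gaugeUnitary_mul_ann (φ : Site D → ℝ) (m : Site D × Spin) :
    gaugeUnitary L φ * ann L m =
      Complex.exp (-(Complex.I * φ m.1)) • (ann L m * gaugeUnitary L φ) := by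
  ext S T
  rw [gaugeUnitary, Matrix.diagonal_mul, Matrix.smul_apply, Matrix.mul_diagonal]
  simp only [ann, Matrix.of_apply, smul_eq_mul]
  split_ifs with h
  · rw [mul_left_comm, ← Complex.exp_add, mul_comm, h.2, ← Finset.add_sum_erase _ _ h.1]
    congr 2
    push_cast
    ring
  · simp

theorem gaugeUnitary_mul_cre (φ : Site D → ℝ) (m : Site D × Spin) :
    gaugeUnitary L φ * cre L m =
      Complex.exp (Complex.I * φ m.1) • (cre L m * gaugeUnitary L φ) := by
  have h := congrArg Matrix.conjTranspose (gaugeUnitary_mul_ann (L := L) (-φ) m)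
  rw [Matrix.conjTranspose_mul, Matrix.conjTranspose_smul, Matrix.conjTranspose_mul,
    gaugeUnitary_conjTranspose, neg_neg] at h
  change cre L m * _ = _ • (_ * cre L m) at h
  rw [h, smul_smul, RCLike.star_def, ← Complex.exp_conj, ← Complex.exp_add]
  simp

theorem gaugeUnitary_mul_cre_mul_ann (φ : Site D → ℝ) (m n : Site D × Spin) :
    gaugeUnitary L φ * (cre L m * ann L n) =
      Complex.exp (Complex.I * (φ m.1 - φ n.1)) • (cre L m * ann L n * gaugeUnitary L φ) := by
  rw [← mul_assoc, gaugeUnitary_mul_cre, Matrix.smul_mul, mul_assoc, gaugeUnitary_mul_ann,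
    Matrix.mul_smul, smul_smul, ← Complex.exp_add, mul_assoc]
  congr 2
  ring

theorem commute_gaugeUnitary_num (φ : Site D → ℝ) (m : Site D × Spin) :
    Commute (gaugeUnitary L φ) (num L m) := by
  rw [Commute, SemiconjBy, num, gaugeUnitary_mul_cre_mul_ann, sub_self, mul_zero, Complex.exp_zero,
    one_smul]

/-- The energy of the electrons in the gauge field `A`. -/
def electronEnergy (M : ElectronModel D) (L : ℕ) (μ : ℝ) (A : Bond D L → ℝ) : FockOp D L :=
  hopping M L A + interaction M L - (μ : ℂ) • totalNumber D L

/-- The phase `φ x - φ y` from commuting past `c†_x c_y` cancels the phase `φ y - φ x` that the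
gradient adds to the hopping; density terms commute with the diagonal unitary. -/
theorem gaugeUnitary_mul_electronEnergy (M : ElectronModel D) (μ : ℝ) (A : Bond D L → ℝ)
    (φ : Site D → ℝ) : gaugeUnitary L φ * electronEnergy M L μ (A + grad L φ) =
      electronEnergy M L μ A * gaugeUnitary L φ := by
  have hh : gaugeUnitary L φ * hopping M L (A + grad L φ) = hopping M L A * gaugeUnitary L φ := by
    simp only [hopping, Finset.mul_sum, Finset.sum_mul]
    refine Finset.sum_congr rfl fun x hx => Finset.sum_congr rfl fun y hy =>
      Finset.sum_congr rfl fun σ _ => Finset.sum_congr rfl fun τ _ => ?_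
    by_cases hxy : NearestNeighbor x y
    · rw [Matrix.mul_smul, Matrix.smul_mul, gaugeUnitary_mul_cre_mul_ann, smul_smul, gauge_add,
        gauge_grad φ hx hy hxy, mul_assoc, ← Complex.exp_add]
      congr 3
      push_cast
      ring
    · simp [M.t_nearest x y σ τ hxy]
  have hi : Commute (gaugeUnitary L φ) (interaction M L) := by
    refine Commute.sum_right _ _ _ fun I _ => Commute.sum_right _ _ _ fun p _ =>
      Commute.smul_right (Commute.list_prod_right _ _ fun n hn => ?_) _
    obtain ⟨j, rfl⟩ := (List.mem_ofFn' _ _).1 hn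
    exact commute_gaugeUnitary_num φ _
  have hn : Commute (gaugeUnitary L φ) (totalNumber D L) :=
    Commute.sum_right _ _ _ fun m _ => commute_gaugeUnitary_num φ m
  rw [electronEnergy, electronEnergy, mul_sub, mul_add, sub_mul, add_mul, hh, hi.eq,
    Matrix.mul_smul, Matrix.smul_mul, hn.eq]

/-- The Boltzmann weight of the electrons transforms covariantly. -/
theorem gaugeUnitary_mul_exp (M : ElectronModel D) (β μ : ℝ) (A : Bond D L → ℝ)
    (φ : Site D → ℝ) :
    NormedSpace.exp (-(β : ℂ) • electronEnergy M L μ (A + grad L φ)) =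
      gaugeUnitary L (-φ) * NormedSpace.exp (-(β : ℂ) • electronEnergy M L μ A) *
        gaugeUnitary L φ := by
  let U : (FockOp D L)ˣ := ⟨gaugeUnitary L (-φ), gaugeUnitary L φ, gaugeUnitary_neg_mul φ,
    gaugeUnitary_mul_neg φ⟩
  have h := Matrix.exp_units_conj U (-(β : ℂ) • electronEnergy M L μ A)
  refine Eq.trans (congrArg _ ?_) h
  change _ = gaugeUnitary L (-φ) * _ * gaugeUnitary L φ
  rw [Matrix.mul_smul, Matrix.smul_mul, mul_assoc, ← gaugeUnitary_mul_electronEnergy, ← mul_assoc,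
    gaugeUnitary_neg_mul, one_mul]

/-- The Cooper-pair operator `c†_{u↑} c†_{v↓} c_{-v↓} c_{-u↑}`. -/
def pairOp (L : ℕ) (u v : Site D) : FockOp D L :=
  cre L (u, up) * cre L (v, down) * ann L (-v, down) * ann L (-u, up)

/-- The charge of the Cooper-pair operator in the function `φ`. -/
def pairCharge (φ : Site D → ℝ) (u v : Site D) : ℝ := φ u + φ v - φ (-v) - φ (-u)

theorem gaugeUnitary_mul_pairOp (φ : Site D → ℝ) (u v : Site D) :
    gaugeUnitary L φ * pairOp L u v =
      Complex.exp (Complex.I * pairCharge φ u v) • (pairOp L u v * gaugeUnitary L φ) := by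
  have h : gaugeUnitary L φ * pairOp L u v =
      gaugeUnitary L φ * cre L (u, up) * cre L (v, down) * ann L (-v, down) * ann L (-u, up) := by
    simp only [pairOp, mul_assoc]
  rw [h, gaugeUnitary_mul_cre, Matrix.smul_mul, mul_assoc (cre L (u, up)), gaugeUnitary_mul_cre,
    Matrix.mul_smul, smul_smul, Matrix.smul_mul, mul_assoc (cre L (u, up)),
    mul_assoc (cre L (v, down)), gaugeUnitary_mul_ann, Matrix.mul_smul, Matrix.mul_smul, smul_smul,
    Matrix.smul_mul, ← mul_assoc, ← mul_assoc, mul_assoc _ (gaugeUnitary L φ), gaugeUnitary_mul_ann,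
    Matrix.mul_smul, smul_smul, ← mul_assoc]
  simp only [← Complex.exp_add]
  rw [pairOp, pairCharge]
  congr 2
  push_cast
  ring

/-- Cyclicity of the trace moves the conjugation from the Boltzmann operator to the pair operator,
which is an eigenvector of it. -/
theorem trace_pairOp_mul_exp_grad (M : ElectronModel D) (β μ : ℝ) (A : Bond D L → ℝ)
    (φ : Site D → ℝ) (u v : Site D) :
    (pairOp L u v * NormedSpace.exp (-(β : ℂ) • electronEnergy M L μ (A + grad L φ))).trace =
      Complex.exp (Complex.I * pairCharge φ u v) *
        (pairOp L u v * NormedSpace.exp (-(β : ℂ) • electronEnergy M L μ A)).trace := by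
  rw [gaugeUnitary_mul_exp, ← mul_assoc, Matrix.trace_mul_comm, ← mul_assoc, ← mul_assoc,
    gaugeUnitary_mul_pairOp, Matrix.smul_mul, Matrix.smul_mul, Matrix.trace_smul, smul_eq_mul,
    mul_assoc (pairOp L u v), gaugeUnitary_mul_neg, mul_one]

end Fock

/-! ### Positivity, Hermiticity and regularity of the Boltzmann weight -/

section Thermal

open scoped Matrix.Norms.L2Operator in
-- The diagonal entries are `⟨b, X b⟩` for the columns `b` of `B`; Cauchy–Schwarz bounds each by
-- `‖X‖ ‖b‖²`.
theorem norm_trace_conjTranspose_mul_mul_le {n : Type*} [Fintype n] [DecidableEq n]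
    (B X : Matrix n n ℂ) : ‖(Bᴴ * X * B).trace‖ ≤ ‖X‖ * (Bᴴ * B).trace.re := by
  have h : ∀ (Y : Matrix n n ℂ) i, (Bᴴ * Y * B) i i =
      inner ℂ (WithLp.toLp 2 (Bᵀ i)) (WithLp.toLp 2 (Y *ᵥ Bᵀ i)) := by
    intro Y i
    rw [EuclideanSpace.inner_eq_star_dotProduct, mul_assoc, Matrix.mul_apply, dotProduct]
    refine Finset.sum_congr rfl fun j _ => ?_
    rw [mul_comm]
    rfl
  have h1 : (Bᴴ * B).trace.re = ∑ i, ‖WithLp.toLp 2 (Bᵀ i)‖ ^ 2 := by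
    have := fun i => h 1 i
    simp only [mul_one, Matrix.one_mulVec] at this
    rw [Matrix.trace, Complex.re_sum]
    refine Finset.sum_congr rfl fun i _ => ?_
    rw [Matrix.diag_apply, this, ← inner_self_eq_norm_sq (𝕜 := ℂ)]
    rfl
  rw [h1, Matrix.trace, Finset.mul_sum]
  refine (norm_sum_le _ _).trans (Finset.sum_le_sum fun i _ => ?_)
  rw [Matrix.diag_apply, h]
  refine (norm_inner_le_norm _ _).trans ?_
  have := Matrix.l2_opNorm_mulVec X (WithLp.toLp 2 (Bᵀ i))
  calc _ ≤ ‖WithLp.toLp 2 (Bᵀ i)‖ * (‖X‖ * ‖WithLp.toLp 2 (Bᵀ i)‖) := by gcongr; exact this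
    _ = _ := by ring

/-- `B` is `exp(-βH/2)`. This self-adjoint square root exhibits the Boltzmann operator as positive.
-/
theorem exp_eq_conjTranspose_mul_self {n : Type*} [Fintype n] [DecidableEq n]
    {H : Matrix n n ℂ} (hH : H.IsHermitian) (β : ℝ) :
    ∃ B : Matrix n n ℂ, Bᴴ = B ∧ NormedSpace.exp (-(β : ℂ) • H) = B * B := by
  have hs : (((-(β / 2) : ℝ) : ℂ) • H).IsHermitian := by
    rw [Matrix.IsHermitian, Matrix.conjTranspose_smul, hH.eq, RCLike.star_def, Complex.conj_ofReal]
  refine ⟨NormedSpace.exp (((-(β / 2) : ℝ) : ℂ) • H), hs.exp.eq, ?_⟩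
  rw [← Matrix.exp_add_of_commute _ _ (Commute.refl _), ← add_smul]
  congr 2
  push_cast
  ring

open scoped Matrix.Norms.L2Operator in
/-- In a thermal state, the expectation of an operator is at most its norm. -/
theorem norm_trace_mul_exp_le {n : Type*} [Fintype n] [DecidableEq n]
    {H : Matrix n n ℂ} (hH : H.IsHermitian) (β : ℝ) (X : Matrix n n ℂ) :
    ‖(X * NormedSpace.exp (-(β : ℂ) • H)).trace‖ ≤
      ‖X‖ * (NormedSpace.exp (-(β : ℂ) • H)).trace.re := by
  obtain ⟨B, hB, h⟩ := exp_eq_conjTranspose_mul_self hH β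
  have := norm_trace_conjTranspose_mul_mul_le B X
  rw [hB] at this
  rwa [h, ← mul_assoc, Matrix.trace_mul_comm, ← mul_assoc]

theorem trace_exp_eq_re {n : Type*} [Fintype n] [DecidableEq n]
    {H : Matrix n n ℂ} (hH : H.IsHermitian) (β : ℝ) :
    (NormedSpace.exp (-(β : ℂ) • H)).trace = ((NormedSpace.exp (-(β : ℂ) • H)).trace.re : ℂ) := by
  obtain ⟨B, hB, h⟩ := exp_eq_conjTranspose_mul_self hH β
  refine (Complex.conj_eq_iff_re.1 ?_).symm
  rw [h, ← RCLike.star_def, ← Matrix.trace_conjTranspose, Matrix.conjTranspose_mul, hB]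

variable {D L : ℕ}

theorem exists_prod_num_eq_diagonal (l : List (Site D × Spin)) :
    ∃ d : Config D L → ℝ, (l.map (num L)).prod = Matrix.diagonal fun S => (d S : ℂ) := by
  induction l with
  | nil => exact ⟨fun _ => 1, by simp⟩
  | cons m l ih =>
    obtain ⟨d, hd⟩ := ih
    refine ⟨fun S => (if m ∈ S.1 then 1 else 0) * d S, ?_⟩
    rw [List.map_cons, List.prod_cons, hd, num_eq_diagonal, Matrix.diagonal_mul_diagonal]
    congr 1
    funext S
    by_cases hm : m ∈ S.1 <;> simp [hm]

theorem isHermitian_electronEnergy (M : ElectronModel D) (μ : ℝ) (A : Bond D L → ℝ) :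
    (electronEnergy M L μ A).IsHermitian := by
  have hsum : ∀ {ι : Type} (s : Finset ι) (f : ι → FockOp D L), (∀ i ∈ s, (f i).IsHermitian) →
      (∑ i ∈ s, f i).IsHermitian := by
    intro ι s f hf
    rw [Matrix.IsHermitian, Matrix.conjTranspose_sum]
    exact Finset.sum_congr rfl fun i hi => (hf i hi).eq
  have hh : (hopping M L A).IsHermitian := by
    simp only [Matrix.IsHermitian, hopping, Matrix.conjTranspose_sum]
    -- The adjoint exchanges `(x, σ)` with `(y, τ)`, so both pairs of sums are swapped before terms
    -- are matched.
    rw [Finset.sum_comm]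
    refine Finset.sum_congr rfl fun x _ => Finset.sum_congr rfl fun y _ => ?_
    rw [Finset.sum_comm]
    refine Finset.sum_congr rfl fun σ _ => Finset.sum_congr rfl fun τ _ => ?_
    rw [Matrix.conjTranspose_smul, Matrix.conjTranspose_mul, cre, cre,
      Matrix.conjTranspose_conjTranspose, star_mul', ← M.t_herm, RCLike.star_def,
      ← Complex.exp_conj, gauge_swap A x y]
    simp
  have hn : ∀ m, (num L m : FockOp D L).IsHermitian := fun m =>
    Matrix.isHermitian_conjTranspose_mul_self _
  have hi : (interaction M L).IsHermitian := by
    refine hsum _ _ fun I _ => hsum _ _ fun p _ => ?_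
    obtain ⟨d, hd⟩ := exists_prod_num_eq_diagonal (L := L) (List.ofFn p)
    rw [List.map_ofFn] at hd
    change (_ • (List.ofFn (num L ∘ p)).prod).IsHermitian
    rw [hd, Matrix.IsHermitian, Matrix.conjTranspose_smul, Matrix.diagonal_conjTranspose,
      RCLike.star_def, Complex.conj_ofReal]
    congr 2
    funext S
    simp
  have hN : (totalNumber D L).IsHermitian := hsum _ _ fun m _ => hn m
  refine (hh.add hi).sub ?_
  rw [Matrix.IsHermitian, Matrix.conjTranspose_smul, hN.eq, RCLike.star_def, Complex.conj_ofReal]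

theorem continuous_electronEnergy (M : ElectronModel D) (μ : ℝ) :
    Continuous (electronEnergy M L μ) := by
  have : Continuous (hopping M L) := by unfold hopping; fun_prop
  unfold electronEnergy
  fun_prop

open scoped Matrix.Norms.L2Operator in
theorem continuous_trace_mul_exp (M : ElectronModel D) (β μ : ℝ) (X : FockOp D L) :
    Continuous fun A => (X * NormedSpace.exp (-(β : ℂ) • electronEnergy M L μ A)).trace := by
  let _ : NormedAlgebra ℚ (FockOp D L) := NormedAlgebra.restrictScalars ℚ ℂ _
  have hc : Continuous fun A : Bond D L → ℝ => -(β : ℂ) • electronEnergy M L μ A :=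
    (continuous_electronEnergy M μ).const_smul (-(β : ℂ))
  have h : Continuous fun A => NormedSpace.exp (-(β : ℂ) • electronEnergy M L μ A) :=
    NormedSpace.exp_continuous.comp hc
  exact (continuous_const.matrix_mul h).matrix_trace

theorem electronEnergy_add_of_mem_periods (M : ElectronModel D) (μ : ℝ) (A : Bond D L → ℝ)
    {n : Bond D L → ℝ} (hn : ∀ b, n b ∈ periods) :
    electronEnergy M L μ (A + n) = electronEnergy M L μ A := by
  simp only [electronEnergy, hopping, gauge_add,
    exp_I_mul_add_of_mem_periods (gauge_mem_periods hn _ _)]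

theorem exp_energy (M : ElectronModel D) (β μ κ α : ℝ) (A : Bond D L → ℝ) :
    NormedSpace.exp (-(β : ℂ) • energy M L μ κ α A) =
      ((Real.exp (β * κ * ∑ p ∈ plaquettes D L, Real.cos (flux A p.1 p.2.1 p.2.2)) *
        Real.exp (β / α * ∑ x ∈ box D L, Real.cos (divergence A x)) : ℝ) : ℂ) •
        NormedSpace.exp (-(β : ℂ) • electronEnergy M L μ A) := by
  have h1 : -(β : ℂ) • energy M L μ κ α A = -(β : ℂ) • electronEnergy M L μ A +
      Matrix.diagonal fun _ => ((-β * gaugeEnergy L κ α A : ℝ) : ℂ) := by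
    rw [energy, electronEnergy, smul_add, smul_smul, ← Matrix.smul_one_eq_diagonal]
    push_cast
    rfl
  have h2 : NormedSpace.exp (Matrix.diagonal fun _ => ((-β * gaugeEnergy L κ α A : ℝ) : ℂ) :
      FockOp D L) = ((Real.exp (-β * gaugeEnergy L κ α A) : ℝ) : ℂ) • 1 := by
    rw [Matrix.exp_diagonal, Matrix.smul_one_eq_diagonal]
    congr 1
    funext S
    rw [Pi.coe_exp, ← Complex.exp_eq_exp_ℂ, Complex.ofReal_exp]
  rw [h1, Matrix.exp_add_of_commute _ _ ?_, h2, Matrix.mul_smul, mul_one, ← Real.exp_add]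
  · congr 3
    rw [gaugeEnergy]
    ring
  · rw [← Matrix.smul_one_eq_diagonal]
    exact (Commute.one_right _).smul_right _

end Thermal

/-! ### Complex translation and the McBryan–Spencer bound -/

section Bound

variable {D L : ℕ}

theorem cos_add_I_mul_re (a b : ℝ) :
    (Complex.cos (a + Complex.I * b)).re = Real.cos a * Real.cosh b := by
  rw [mul_comm, Complex.cos_add_mul_I]
  simp [← Complex.ofReal_cos, ← Complex.ofReal_cosh, ← Complex.ofReal_sin, ← Complex.ofReal_sinh]

open scoped Matrix.Norms.L2Operator in
theorem norm_pairOp_le_one (u v : Site D) : ‖pairOp L u v‖ ≤ 1 := by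
  have hc : ∀ m : Site D × Spin, ‖cre L m‖ ≤ 1 := fun m => by
    rw [cre, Matrix.l2_opNorm_conjTranspose]; exact norm_ann_le_one m
  have mul : ∀ a b : FockOp D L, ‖a‖ ≤ 1 → ‖b‖ ≤ 1 → ‖a * b‖ ≤ 1 := fun a b ha hb =>
    (norm_mul_le a b).trans (mul_le_one₀ ha (norm_nonneg _) hb)
  exact mul _ _ (mul _ _ (mul _ _ (hc _) (hc _)) (norm_ann_le_one _)) (norm_ann_le_one _)

/-- Complex deformation of the gauge field by a multiple of a pure gauge field: the weight of the
Cooper-pair operator does not change. -/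
theorem weight_pairOp_eq (M : ElectronModel D) (β μ κ α : ℝ) (θ : Site D → ℝ) (u v : Site D)
    (z : ℂ) :
    weight M L β μ κ α (pairOp L u v) =
      ∫ A in Set.Icc (fun _ : Bond D L => -Real.pi) (fun _ => Real.pi),
        ((Real.exp (β * κ * ∑ p ∈ plaquettes D L, Real.cos (flux A p.1 p.2.1 p.2.2)) : ℝ) : ℂ) *
        (pairOp L u v * NormedSpace.exp (-(β : ℂ) • electronEnergy M L μ A)).trace *
        Complex.exp (Complex.I * z * pairCharge θ u v + (β / α : ℝ) *
          ∑ x ∈ box D L, Complex.cos (divergence A x + z * divergence (grad L θ) x)) := by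
  set P : (Bond D L → ℝ) → ℂ := fun A =>
    ((Real.exp (β * κ * ∑ p ∈ plaquettes D L, Real.cos (flux A p.1 p.2.1 p.2.2)) : ℝ) : ℂ) *
        (pairOp L u v * NormedSpace.exp (-(β : ℂ) • electronEnergy M L μ A)).trace with hP
  set Θ := pairCharge θ u v
  set ρ := divergence (grad L θ)
  set Φ : ℂ → (Bond D L → ℝ) → ℂ := fun z A => P A *
    Complex.exp (Complex.I * z * Θ + (β / α : ℝ) *
      ∑ x ∈ box D L, Complex.cos (divergence A x + z * ρ x)) with hΦ
  change _ = ∫ A in _, Φ z A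
  have hPc : Continuous P := by
    have := continuous_trace_mul_exp M β μ (pairOp L u v)
    fun_prop
  have hw : weight M L β μ κ α (pairOp L u v) = ∫ A in Set.Icc (fun _ : Bond D L => -Real.pi)
      (fun _ => Real.pi), Φ 0 A := by
    refine integral_congr_ae (Eventually.of_forall fun A => ?_)
    simp only [exp_energy, Matrix.mul_smul, Matrix.trace_smul, hΦ, hP]
    push_cast
    simp only [smul_eq_mul, mul_zero, zero_mul, zero_add, add_zero]
    ring
  have hdiff : Differentiable ℂ fun z => ∫ A in Set.Icc (fun _ : Bond D L => -Real.pi)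
      (fun _ => Real.pi), Φ z A := by
    refine differentiable_setIntegral isCompact_Icc (Φ := Φ) (Φ' := fun z A => P A *
      (Complex.exp (Complex.I * z * Θ + (β / α : ℝ) *
        ∑ x ∈ box D L, Complex.cos (divergence A x + z * ρ x)) *
        (Complex.I * Θ + (β / α : ℝ) *
          ∑ x ∈ box D L, -Complex.sin (divergence A x + z * ρ x) * ρ x))) ?_ ?_ ?_
    · simp only [hΦ, Function.uncurry_def]
      fun_prop
    · simp only [Function.uncurry_def]
      fun_prop
    · intro z A
      refine HasDerivAt.const_mul (P A) (HasDerivAt.cexp (HasDerivAt.add ?_ (HasDerivAt.const_mul _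
        (HasDerivAt.fun_sum fun x _ => HasDerivAt.ccos ?_))))
      · simpa using! ((hasDerivAt_id z).const_mul Complex.I).mul_const (Θ : ℂ)
      · simpa using! ((hasDerivAt_id z).mul_const (ρ x : ℂ)).const_add (divergence A x : ℂ)
  -- The point is that `Φ τ A = Φ 0 (A + grad L (τ • θ))` for real `τ`: fluxes are unchanged, the
  -- trace gives the phase, the divergence gives the shift.
  have hreal : ∀ τ : ℝ, ∫ A in Set.Icc (fun _ : Bond D L => -Real.pi) (fun _ => Real.pi), Φ τ A =
      ∫ A in Set.Icc (fun _ : Bond D L => -Real.pi) (fun _ => Real.pi), Φ 0 A := by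
    intro τ
    have hc : Continuous (Φ 0) := by simp only [hΦ]; fun_prop
    rw [← setIntegral_add_eq_of_periodic (Φ 0) hc ?_ (grad L (τ • θ))]
    · refine integral_congr_ae (Eventually.of_forall fun A => ?_)
      simp only [hΦ, hP, trace_pairOp_mul_exp_grad]
      have e1 : ∑ p ∈ plaquettes D L, Real.cos (flux (A + grad L (τ • θ)) p.1 p.2.1 p.2.2) =
          ∑ p ∈ plaquettes D L, Real.cos (flux A p.1 p.2.1 p.2.2) :=
        Finset.sum_congr rfl fun p hp => by rw [flux_add, flux_grad _ hp, add_zero]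
      have e2 : ∀ x, divergence (A + grad L (τ • θ)) x = divergence A x + τ * ρ x := fun x => by
        rw [divergence_add, grad_smul, divergence_smul]
      have e3 : pairCharge (τ • θ) u v = τ * Θ := by
        simp only [Θ, pairCharge, Pi.smul_apply, smul_eq_mul]; ring
      rw [e1, e3, Complex.exp_add]
      simp only [e2]
      push_cast
      simp only [mul_zero, zero_mul, zero_add, add_zero, mul_assoc]
      ring
    · intro A n
      have hn : ∀ b, (fun b => (n b : ℝ) * (2 * Real.pi)) b ∈ periods := fun b =>
        AddSubgroup.mem_zmultiples_iff.2 ⟨n b, zsmul_eq_mul _ _⟩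
      simp only [hΦ, hP, electronEnergy_add_of_mem_periods M μ A hn, flux_add, divergence_add,
        cos_add_of_mem_periods (flux_mem_periods hn _ _ _), zero_mul, add_zero,
        ← Complex.ofReal_cos, cos_add_of_mem_periods (divergence_mem_periods hn _)]
  rw [hw]
  exact (eq_of_forall_real_eq hdiff (by simpa using hreal) z).symm

open scoped Matrix.Norms.L2Operator ComplexOrder in
/-- The McBryan–Spencer bound for the Cooper-pair correlation, for an arbitrary test function. -/
theorem norm_cooperCorrelation_le (M : ElectronModel D) {β α : ℝ} (hβ : 0 < β) (hα : 0 < α)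
    (μ κ : ℝ) (θ : Site D → ℝ) (u v : Site D) (q : ℝ) :
    ‖cooperCorrelation M L β μ κ α u v‖ ≤ Real.exp (-(q * pairCharge θ u v) +
      β / α * ∑ x ∈ box D L, (Real.cosh (q * divergence (grad L θ) x) - 1)) := by
  set K := Set.Icc (fun _ : Bond D L => -Real.pi) (fun _ => Real.pi)
  set E := Real.exp (-(q * pairCharge θ u v) +
      β / α * ∑ x ∈ box D L, (Real.cosh (q * divergence (grad L θ) x) - 1)) with hE
  set Z : (Bond D L → ℝ) → ℝ := fun A =>
    Real.exp (β * κ * ∑ p ∈ plaquettes D L, Real.cos (flux A p.1 p.2.1 p.2.2)) *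
        Real.exp (β / α * ∑ x ∈ box D L, Real.cos (divergence A x)) *
      (NormedSpace.exp (-(β : ℂ) • electronEnergy M L μ A)).trace.re with hZ
  have htr : ∀ A, 0 ≤ (NormedSpace.exp (-(β : ℂ) • electronEnergy M L μ A)).trace.re := by
    intro A
    obtain ⟨B, hB, h⟩ := exp_eq_conjTranspose_mul_self (isHermitian_electronEnergy M μ A) β
    rw [h]
    nth_rw 1 [← hB]
    exact (Complex.le_def.1 (Matrix.posSemidef_conjTranspose_mul_self B).trace_nonneg).1
  have hZc : Continuous Z := by
    have h := continuous_trace_mul_exp (L := L) M β μ 1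
    simp only [one_mul] at h
    have := Complex.continuous_re.comp h
    simp only [Function.comp_def] at this
    fun_prop
  have hZ0 : 0 ≤ ∫ A in K, Z A := integral_nonneg fun A => by
    have := htr A
    positivity
  have h1 : weight M L β μ κ α 1 = ((∫ A in K, Z A : ℝ) : ℂ) := by
    rw [← integral_complex_ofReal]
    refine integral_congr_ae (Eventually.of_forall fun A => ?_)
    simp only [one_mul, exp_energy, Matrix.trace_smul, smul_eq_mul, hZ]
    rw [trace_exp_eq_re (isHermitian_electronEnergy M μ A)]
    push_cast
    rfl
  have hO : ‖weight M L β μ κ α (pairOp L u v)‖ ≤ E * ∫ A in K, Z A := by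
    -- At `z = iq` the phase has modulus `exp(-qΘ)`.
    rw [weight_pairOp_eq M β μ κ α θ u v (Complex.I * q), ← integral_const_mul]
    refine norm_integral_le_of_norm_le ((hZc.const_mul E).continuousOn.integrableOn_compact
      isCompact_Icc) (Eventually.of_forall fun A => ?_)
    have h2 := (norm_trace_mul_exp_le (isHermitian_electronEnergy M μ A) β (pairOp L u v)).trans
      (mul_le_of_le_one_left (htr A) (norm_pairOp_le_one u v))
    rw [norm_mul, norm_mul, Complex.norm_exp, Complex.norm_real, Real.norm_of_nonneg
      (Real.exp_pos _).le]
    have h3 : (Complex.I * (Complex.I * q) * pairCharge θ u v + (β / α : ℝ) *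
        ∑ x ∈ box D L, Complex.cos (divergence A x + Complex.I * q * divergence (grad L θ) x)).re ≤
        β / α * ∑ x ∈ box D L, Real.cos (divergence A x) + (-(q * pairCharge θ u v) +
      β / α * ∑ x ∈ box D L, (Real.cosh (q * divergence (grad L θ) x) - 1)) := by
      have e : Complex.I * (Complex.I * q) * pairCharge θ u v =
          ((-(q * pairCharge θ u v) : ℝ) : ℂ) := by
        rw [← mul_assoc, Complex.I_mul_I]; push_cast; ring
      rw [e, Complex.add_re, Complex.ofReal_re, Complex.re_ofReal_mul, Complex.re_sum]
      -- With `a = (d*A)_x` and `b` its imaginary shift, `cos a cosh b ≤ cos a + (cosh b - 1)`: the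
      -- `cos a` part rebuilds the original weight, and the rest no longer depends on `A`.
      have hs : ∑ x ∈ box D L, (Complex.cos (divergence A x +
          Complex.I * q * divergence (grad L θ) x)).re ≤ ∑ x ∈ box D L, Real.cos (divergence A x) +
          ∑ x ∈ box D L, (Real.cosh (q * divergence (grad L θ) x) - 1) := by
        rw [← Finset.sum_add_distrib]
        refine Finset.sum_le_sum fun x _ => ?_
        have := cos_add_I_mul_re (divergence A x) (q * divergence (grad L θ) x)
        rw [Complex.ofReal_mul, ← mul_assoc] at this
        rw [this]
        nlinarith [Real.cos_le_one (divergence A x),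
          Real.one_le_cosh (q * divergence (grad L θ) x)]
      have := mul_le_mul_of_nonneg_left hs (div_pos hβ hα).le
      linarith
    calc _ ≤ Real.exp (β * κ * ∑ p ∈ plaquettes D L, Real.cos (flux A p.1 p.2.1 p.2.2)) *
          (NormedSpace.exp (-(β : ℂ) • electronEnergy M L μ A)).trace.re *
          Real.exp (β / α * ∑ x ∈ box D L, Real.cos (divergence A x) +
            (-(q * pairCharge θ u v) +
              β / α * ∑ x ∈ box D L, (Real.cosh (q * divergence (grad L θ) x) - 1))) := by
          gcongr
          exact mul_nonneg (Real.exp_pos _).le (htr A)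
      _ = _ := by rw [Real.exp_add, ← hE, hZ]; ring
  change ‖weight M L β μ κ α (pairOp L u v) / weight M L β μ κ α 1‖ ≤ E
  rw [norm_div, h1, Complex.norm_real, Real.norm_of_nonneg hZ0]
  -- Nonnegativity of the partition function suffices, since a quotient by `0` is `0`.
  exact div_le_of_le_mul₀ hZ0 (Real.exp_pos _).le hO

end Bound

/-! ### Test functions -/

/-- The profile `(1 - y)_+ ^ 2`. -/
def cutoff (y : ℝ) : ℝ := max 0 (1 - y) ^ 2

theorem cutoff_of_one_le {y : ℝ} (h : 1 ≤ y) : cutoff y = 0 := by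
  rw [cutoff, max_eq_left (by linarith)]; norm_num

theorem cutoff_zero : cutoff 0 = 1 := by norm_num [cutoff]

theorem one_sub_two_mul_le_cutoff (y : ℝ) : 1 - 2 * y ≤ cutoff y := by
  rw [cutoff]
  rcases le_total 0 (1 - y) with h | h
  · rw [max_eq_right h]; nlinarith [sq_nonneg y]
  · rw [max_eq_left h]; linarith

/-- Taylor expansion: the derivative of `cutoff` is `-2 (1 - y)_+`, and its second derivative lies
between `0` and `2`, apart from the kink of the derivative at `1`. -/
theorem cutoff_add_bounds (y d : ℝ) :
    -2 * max 0 (1 - y) * d ≤ cutoff (y + d) - cutoff y ∧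
      cutoff (y + d) - cutoff y ≤ -2 * max 0 (1 - y) * d + d ^ 2 := by
  simp only [cutoff]
  rcases le_total 0 (1 - y) with h | h <;> rcases le_total 0 (1 - (y + d)) with h' | h' <;>
    simp only [max_eq_left, max_eq_right, h, h'] <;> constructor <;>
    nlinarith [sq_nonneg d, sq_nonneg (1 - y), sq_nonneg (1 - (y + d))]

/-- The square of the Euclidean length. -/
def sqNorm {D : ℕ} (x : Site D) : ℝ := ∑ i, (x i : ℝ) ^ 2

section Bump

variable {D : ℕ}

theorem siteNorm_sq (x : Site D) : siteNorm x ^ 2 = sqNorm x :=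
  Real.sq_sqrt (Finset.sum_nonneg fun _ _ => sq_nonneg _)

theorem siteNorm_nonneg (x : Site D) : 0 ≤ siteNorm x := Real.sqrt_nonneg _

theorem siteNorm_eq_norm (x : Site D) :
    siteNorm x = ‖(WithLp.toLp 2 fun i => (x i : ℝ) : EuclideanSpace ℝ (Fin D))‖ := by
  rw [EuclideanSpace.norm_eq]
  simp [siteNorm]

theorem siteNorm_add_le (x y : Site D) : siteNorm (x + y) ≤ siteNorm x + siteNorm y := by
  simp only [siteNorm_eq_norm]
  refine le_trans (le_of_eq ?_) (norm_add_le _ _)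
  congr 1
  ext i
  simp

theorem sq_le_sqNorm (x : Site D) (i : Fin D) : (x i : ℝ) ^ 2 ≤ sqNorm x :=
  Finset.single_le_sum (f := fun i => (x i : ℝ) ^ 2) (fun _ _ => sq_nonneg _) (Finset.mem_univ i)

theorem sqNorm_nonneg (x : Site D) : 0 ≤ sqNorm x := Finset.sum_nonneg fun _ _ => sq_nonneg _

theorem sqNorm_add_unitVec (x : Site D) (i : Fin D) :
    sqNorm (x + unitVec i) = sqNorm x + (2 * x i + 1) := by
  have : ∀ j, (((x + unitVec i) j : ℤ) : ℝ) ^ 2 = (x j : ℝ) ^ 2 +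
      if j = i then 2 * (x i : ℝ) + 1 else 0 := by
    intro j
    by_cases h : j = i
    · subst h; simp [unitVec]; ring
    · simp [unitVec, h]
  simp only [sqNorm, this, Finset.sum_add_distrib]
  simp

theorem sqNorm_sub_unitVec (x : Site D) (i : Fin D) :
    sqNorm (x - unitVec i) = sqNorm x + (-2 * x i + 1) := by
  have h := sqNorm_add_unitVec (x - unitVec i) i
  rw [sub_add_cancel] at h
  have h2 : (((x - unitVec i) i : ℤ) : ℝ) = x i - 1 := by simp [unitVec]
  rw [h2] at h
  linarith

/-- A bump of radius `R` around the origin. -/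
def bump (R : ℝ) (x : Site D) : ℝ := cutoff (sqNorm x / R ^ 2)

theorem bump_eq_zero {R : ℝ} (hR : 0 < R) {x : Site D} (h : R ^ 2 ≤ sqNorm x) : bump R x = 0 :=
  cutoff_of_one_le ((one_le_div (by positivity)).2 h)

theorem bump_eq_zero_of_le_abs {R : ℝ} (hR : 0 < R) {x : Site D} {j : Fin D}
    (h : R ≤ |(x j : ℝ)|) : bump R x = 0 := by
  refine bump_eq_zero hR (le_trans ?_ (sq_le_sqNorm x j))
  rw [← sq_abs (x j : ℝ)]
  gcongr

theorem bump_zero (R : ℝ) : bump R (0 : Site D) = 1 := by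
  simp [bump, sqNorm, cutoff_zero]

theorem one_sub_le_bump (R : ℝ) (x : Site D) : 1 - 2 * (sqNorm x / R ^ 2) ≤ bump R x :=
  one_sub_two_mul_le_cutoff _

theorem bump_neighbors_eq_zero {R : ℝ} (hR : 1 ≤ R) {x : Site D} {j : Fin D}
    (h : R + 1 < |(x j : ℝ)|) (i : Fin D) :
    bump R (x + unitVec i) = 0 ∧ bump R (x - unitVec i) = 0 ∧ bump R x = 0 := by
  have hu : |((unitVec i : Site D) j : ℝ)| ≤ 1 := by
    by_cases hk : j = i
    · subst hk; simp [unitVec]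
    · simp [unitVec, hk]
  have hR0 : 0 < R := by linarith
  refine ⟨bump_eq_zero_of_le_abs hR0 (j := j) ?_, bump_eq_zero_of_le_abs hR0 (j := j) ?_,
    bump_eq_zero_of_le_abs hR0 (j := j) (by linarith)⟩
  · have := abs_sub_abs_le_abs_sub (x j : ℝ) (-((unitVec i : Site D) j : ℝ))
    rw [abs_neg, sub_neg_eq_add] at this
    push_cast [Pi.add_apply]
    linarith
  · have := abs_sub_abs_le_abs_sub (x j : ℝ) ((unitVec i : Site D) j : ℝ)
    push_cast [Pi.sub_apply]
    linarith

/-- A step `±e_i` changes `|x|²` by `±2t + 1`, `t = x i`. The parts linear in `t` cancel, leaving a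
first-order term in `[-4/R², 0]` and a remainder of at most `(8t² + 2)/R⁴`. Unless all three values
vanish, `|t| ≤ R + 1 ≤ 2R`, which gives the `34`. -/
theorem abs_second_difference_bump_le {R : ℝ} (hR : 1 ≤ R) (x : Site D) (i : Fin D) :
    |bump R (x + unitVec i) + bump R (x - unitVec i) - 2 * bump R x| ≤ 34 / R ^ 2 := by
  have hR0 : 0 < R := by linarith
  by_cases h : R + 1 < |(x i : ℝ)|
  · obtain ⟨h1, h2, h3⟩ := bump_neighbors_eq_zero hR h i
    rw [h1, h2, h3]
    simp only [mul_zero, add_zero, sub_zero, abs_zero]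
    positivity
  · push Not at h
    set t : ℝ := ((x i : ℤ) : ℝ)
    set y := sqNorm x / R ^ 2 with hy
    have e1 : bump R (x + unitVec i) = cutoff (y + (2 * t + 1) / R ^ 2) := by
      rw [bump, sqNorm_add_unitVec, add_div]
    have e2 : bump R (x - unitVec i) = cutoff (y + (-2 * t + 1) / R ^ 2) := by
      rw [bump, sqNorm_sub_unitVec, add_div]
    have e3 : bump R x = cutoff y := rfl
    have hy0 : 0 ≤ y := div_nonneg (sqNorm_nonneg x) (by positivity)
    have hp0 : 0 ≤ max 0 (1 - y) := le_max_left _ _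
    have hp1 : max 0 (1 - y) ≤ 1 := max_le zero_le_one (by linarith)
    obtain ⟨l1, u1⟩ := cutoff_add_bounds y ((2 * t + 1) / R ^ 2)
    obtain ⟨l2, u2⟩ := cutoff_add_bounds y ((-2 * t + 1) / R ^ 2)
    have hsum : (2 * t + 1) / R ^ 2 + (-2 * t + 1) / R ^ 2 = 2 / R ^ 2 := by ring
    have hRi : 0 < 1 / R ^ 2 := by positivity
    have hsq : ((2 * t + 1) / R ^ 2) ^ 2 + ((-2 * t + 1) / R ^ 2) ^ 2 ≤ 34 / R ^ 2 := by
      have ht : t ^ 2 ≤ (R + 1) ^ 2 := by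
        rw [← sq_abs t]; gcongr
      have e : ((2 * t + 1) / R ^ 2) ^ 2 + ((-2 * t + 1) / R ^ 2) ^ 2 =
          (8 * t ^ 2 + 2) / R ^ 2 / R ^ 2 := by ring
      rw [e]
      gcongr
      rw [div_le_iff₀ (by positivity)]
      nlinarith
    have hprod : -2 * max 0 (1 - y) * ((2 * t + 1) / R ^ 2) +
        -2 * max 0 (1 - y) * ((-2 * t + 1) / R ^ 2) = -(max 0 (1 - y) * (4 * (1 / R ^ 2))) := by
      ring
    have hpa : 0 ≤ max 0 (1 - y) * (4 * (1 / R ^ 2)) := by positivity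
    have hpb : max 0 (1 - y) * (4 * (1 / R ^ 2)) ≤ 1 * (4 * (1 / R ^ 2)) := by gcongr
    have e34 : 34 / R ^ 2 = 34 * (1 / R ^ 2) := by ring
    rw [e34] at hsq
    rw [e1, e2, e3, e34, abs_le]
    constructor <;> linarith

theorem laplacian_bump_eq_zero {R : ℝ} (hR : 1 ≤ R) {x : Site D} {j : Fin D}
    (h : R + 1 < |(x j : ℝ)|) : laplacian (bump R) x = 0 :=
  Finset.sum_eq_zero fun i _ => by
    obtain ⟨h1, h2, h3⟩ := bump_neighbors_eq_zero hR h i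
    rw [h1, h2, h3]; ring

theorem abs_laplacian_bump_le {R : ℝ} (hR : 1 ≤ R) (x : Site D) :
    |laplacian (bump R) x| ≤ D * (34 / R ^ 2) := by
  refine (Finset.abs_sum_le_sum_abs _ _).trans ((Finset.sum_le_sum fun i _ =>
    abs_second_difference_bump_le hR x i).trans (le_of_eq ?_))
  simp

theorem laplacian_comp_sub (θ : Site D → ℝ) (w x : Site D) :
    laplacian (fun x => θ (x - w)) x = laplacian θ (x - w) := by
  refine Finset.sum_congr rfl fun i _ => ?_
  simp only [add_sub_right_comm, sub_right_comm]

theorem laplacian_const_mul (a : ℝ) (θ : Site D → ℝ) (x : Site D) :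
    laplacian (fun x => a * θ x) x = a * laplacian θ x := by
  rw [laplacian, laplacian, Finset.mul_sum]
  exact Finset.sum_congr rfl fun i _ => by ring

theorem laplacian_sum {ι : Type*} (s : Finset ι) (θ : ι → Site D → ℝ) (x : Site D) :
    laplacian (fun x => ∑ k ∈ s, θ k x) x = ∑ k ∈ s, laplacian (θ k) x := by
  simp only [laplacian]
  rw [Finset.sum_comm]
  refine Finset.sum_congr rfl fun i _ => ?_
  rw [Finset.sum_sub_distrib, Finset.sum_add_distrib, ← Finset.mul_sum]

/-- The points lie in a cube of side `2⌊R + 1⌋ + 1 ≤ 2R + 3 ≤ 5R`. -/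
theorem card_filter_abs_sub_le {R : ℝ} (hR : 1 ≤ R) (w : Site D) (F : Finset (Site D)) :
    ((F.filter fun x => ∀ j, |((x - w) j : ℝ)| ≤ R + 1).card : ℝ) ≤ (5 * R) ^ D := by
  set N : ℤ := ⌊R + 1⌋
  have hN0 : 0 ≤ N := Int.floor_nonneg.2 (by linarith)
  have hN : (N : ℝ) ≤ R + 1 := Int.floor_le _
  have hsub : F.filter (fun x => ∀ j, |((x - w) j : ℝ)| ≤ R + 1) ⊆
      Fintype.piFinset fun j => Finset.Icc (w j - N) (w j + N) := by
    intro x hx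
    rw [Finset.mem_filter] at hx
    refine Fintype.mem_piFinset.2 fun j => ?_
    have h := hx.2 j
    rw [← Int.cast_abs] at h
    have h' := abs_le.1 (Int.le_floor.2 h)
    rw [Pi.sub_apply] at h'
    rw [Finset.mem_Icc]
    constructor <;> linarith [h'.1, h'.2]
  have hc : (Fintype.piFinset fun j => Finset.Icc (w j - N) (w j + N)).card =
      (2 * N + 1).toNat ^ D := by
    rw [Fintype.card_piFinset]
    simp only [Int.card_Icc]
    rw [Finset.prod_congr rfl fun j _ => by
      rw [show w j + N + 1 - (w j - N) = 2 * N + 1 by ring], Finset.prod_const]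
    simp
  have h1 : ((2 * N + 1).toNat : ℝ) = 2 * N + 1 := by
    have : (((2 * N + 1).toNat : ℤ) : ℝ) = ((2 * N + 1 : ℤ) : ℝ) := by
      rw [Int.toNat_of_nonneg (by linarith)]
    push_cast at this
    exact this
  calc _ ≤ (((2 * N + 1).toNat ^ D : ℕ) : ℝ) := by
        exact_mod_cast (Finset.card_le_card hsub).trans hc.le
    _ = (2 * N + 1 : ℝ) ^ D := by push_cast; rw [h1]
    _ ≤ _ := by
        have : (0 : ℝ) ≤ N := by exact_mod_cast hN0
        gcongr
        linarith

/-- Only the support of the first bump is counted. Taking it as the smaller one yields, for `D = 4`,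
the factor `(R/R')²` that makes different scales almost orthogonal. -/
theorem sum_abs_laplacian_bump_mul_le {R R' : ℝ} (hR : 1 ≤ R) (hR' : 1 ≤ R') (w : Site D)
    (F : Finset (Site D)) :
    ∑ x ∈ F, |laplacian (bump R) (x - w)| * |laplacian (bump R') (x - w)| ≤
      (5 * R) ^ D * (D * (34 / R ^ 2) * (D * (34 / R' ^ 2))) := by
  have hz : ∀ x ∈ F, |laplacian (bump R) (x - w)| * |laplacian (bump R') (x - w)| ≠ 0 →
      ∀ j, |((x - w) j : ℝ)| ≤ R + 1 := by
    intro x _ hx j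
    by_contra h
    push Not at h
    exact hx (by rw [laplacian_bump_eq_zero hR h]; simp)
  rw [← Finset.sum_filter_of_ne hz]
  refine (Finset.sum_le_card_nsmul _ _ (D * (34 / R ^ 2) * (D * (34 / R' ^ 2)))
    fun x _ => ?_).trans ?_
  · gcongr
    exacts [abs_laplacian_bump_le hR _, abs_laplacian_bump_le hR' _]
  · rw [nsmul_eq_mul]
    gcongr
    exact card_filter_abs_sub_le hR w F

/-- For all pairs `u, v` with `u` far from the origin there are test functions with a bounded
Laplacian whose charge grows like `2 c g(|u|)` and whose energy grows at most like
`4 c g(|u|)`. -/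
def HasTestFunctions (D : ℕ) (g : ℝ → ℝ) (J c : ℝ) : Prop :=
  ∀ r : ℝ, ∃ C R₀ : ℝ, ∀ u v : Site D, siteNorm (u - v) ≤ r → R₀ ≤ siteNorm u →
    ∃ θ : Site D → ℝ, (∃ N : ℕ, ∀ x, θ x ≠ 0 → ∀ i, |x i| ≤ N) ∧
      (∀ x, |laplacian θ x| ≤ J) ∧ 2 * c * g (siteNorm u) - C ≤ pairCharge θ u v ∧
      ∀ F : Finset (Site D), ∑ x ∈ F, laplacian θ x ^ 2 ≤ 4 * c * g (siteNorm u) + C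

theorem abs_le_of_bump_sub_ne_zero {R : ℝ} (hR : 0 < R) {w x : Site D} (h : bump R (x - w) ≠ 0)
    (i : Fin D) : |x i| ≤ ((∑ j, (w j).natAbs + ⌈R⌉₊ : ℕ) : ℤ) := by
  have h1 : |((x - w) i : ℝ)| < R := by
    by_contra h'
    exact h (bump_eq_zero_of_le_abs hR (not_lt.1 h'))
  have h2 : |(x - w) i| ≤ (⌈R⌉₊ : ℤ) := by
    have : |((x - w) i : ℝ)| ≤ (⌈R⌉₊ : ℝ) := h1.le.trans (Nat.le_ceil R)
    exact_mod_cast this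
  have h3 : (w i).natAbs ≤ ∑ j, (w j).natAbs :=
    Finset.single_le_sum (f := fun j => (w j).natAbs) (fun _ _ => Nat.zero_le _)
      (Finset.mem_univ i)
  have h4 := abs_add_le ((x - w) i) (w i)
  rw [Pi.sub_apply, sub_add_cancel] at h4
  rw [Pi.sub_apply] at h2
  have h5 : |w i| = ((w i).natAbs : ℤ) := (Int.natCast_natAbs _).symm
  push_cast
  have h6 : ((w i).natAbs : ℤ) ≤ ∑ j, ((w j).natAbs : ℤ) := by exact_mod_cast h3
  push_cast at h6 h5
  linarith

/-- A bump of radius at most `|u|` around `u` vanishes at `-u`, and at `-v` if `v` is close to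
`u`. -/
theorem bump_neg_sub_eq_zero {R r : ℝ} (hR : 0 < R) {u v : Site D} (huv : siteNorm (u - v) ≤ r)
    (hRu : R ≤ siteNorm u) (hru : r ≤ siteNorm u) :
    bump R (-v - u) = 0 ∧ bump R (-u - u) = 0 := by
  have h2 : ∀ x : Site D, siteNorm (-x) = siteNorm x := fun x => by simp [siteNorm]
  have key : ∀ v : Site D, siteNorm (u - v) ≤ siteNorm u → bump R (-v - u) = 0 := by
    intro v hv
    refine bump_eq_zero hR ?_
    rw [← siteNorm_sq]
    have h1 : siteNorm (u + u) = 2 * siteNorm u := by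
      have e : ∀ i, (((u + u) i : ℤ) : ℝ) ^ 2 = 4 * (u i : ℝ) ^ 2 := fun i => by
        push_cast [Pi.add_apply]; ring
      rw [siteNorm, siteNorm]
      simp only [e, ← Finset.mul_sum]
      rw [Real.sqrt_mul (by norm_num), show (4 : ℝ) = 2 ^ 2 by norm_num,
        Real.sqrt_sq (by norm_num)]
    have h3 := siteNorm_add_le (u + v) (u - v)
    rw [show u + v + (u - v) = u + u by abel, h1] at h3
    have h4 := h2 (u + v)
    rw [show -(u + v) = -v - u by abel] at h4
    rw [h4]
    gcongr
    linarith
  refine ⟨key v (huv.trans hru), key u ?_⟩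
  rw [sub_self]
  simp [siteNorm]

theorem one_sub_le_bump_sub {R r : ℝ} (hR : 0 < R) {u v : Site D} (huv : siteNorm (u - v) ≤ r) :
    1 - 2 * (r ^ 2 / R ^ 2) ≤ bump R (v - u) := by
  refine le_trans ?_ (one_sub_le_bump R (v - u))
  have h : sqNorm (v - u) ≤ r ^ 2 := by
    have e : sqNorm (v - u) = sqNorm (u - v) := by
      refine Finset.sum_congr rfl fun i _ => ?_
      push_cast [Pi.sub_apply]; ring
    rw [e, ← siteNorm_sq]
    have := siteNorm_nonneg (u - v)
    gcongr
  gcongr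

end Bump

/-! ### Test functions in three dimensions -/

theorem hasTestFunctions_three : ∃ J : ℝ, 0 < J ∧ ∃ c : ℝ, 0 < c ∧
    HasTestFunctions 3 (fun a => a) J c := by
  -- `B / R` bounds the energy of a unit bump: `(5R)³ (3 · 34/R²)²`. At height `cR` the energy is at
  -- most `c²BR`, so `c = 4/B` makes it `4cR`.
  obtain ⟨B, hB⟩ : ∃ B : ℝ, B = 125 * 102 ^ 2 := ⟨_, rfl⟩
  have hB0 : 0 < B := by rw [hB]; norm_num
  refine ⟨102 * (4 / B), by positivity, 4 / B, by positivity, fun r => ?_⟩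
  set c := 4 / B with hc
  have hc0 : 0 < c := by positivity
  -- The constant is the charge lost because the bump at `v` is only `1 - 2r²/R²`. The threshold
  -- ensures `R ≥ 1` and that the bump vanishes at `-v`.
  refine ⟨c * (2 * r ^ 2), max 1 r, fun u v huv hu => ?_⟩
  set R := siteNorm u
  have hR1 : 1 ≤ R := (le_max_left _ _).trans hu
  have hR0 : 0 < R := by linarith
  have hlap : ∀ x, laplacian (fun x => c * R * bump R (x - u)) x =
      c * R * laplacian (bump R) (x - u) := fun x => by
    rw [laplacian_const_mul, laplacian_comp_sub]
  refine ⟨fun x => c * R * bump R (x - u), ⟨_, fun x hx i =>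
    abs_le_of_bump_sub_ne_zero hR0 (right_ne_zero_of_mul hx) i⟩, fun x => ?_, ?_, fun F => ?_⟩
  · rw [hlap, abs_mul, abs_of_pos (by positivity)]
    calc c * R * |laplacian (bump R) (x - u)| ≤ c * R * ((3 : ℕ) * (34 / R ^ 2)) := by
          gcongr; exact abs_laplacian_bump_le hR1 _
      _ = 102 * c * (1 / R) := by push_cast; field_simp; norm_num
      _ ≤ 102 * c * 1 := by
          gcongr
          rw [div_le_one hR0]; exact hR1
      _ = _ := by ring
  · obtain ⟨h1, h2⟩ := bump_neg_sub_eq_zero hR0 huv le_rfl ((le_max_right _ _).trans hu)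
    have h3 := one_sub_le_bump_sub hR0 huv
    simp only [pairCharge, h1, h2, sub_self, bump_zero]
    have h4 : r ^ 2 / R ^ 2 * R ≤ r ^ 2 := by
      rw [show r ^ 2 / R ^ 2 * R = r ^ 2 / R by field_simp]
      exact div_le_self (sq_nonneg r) hR1
    have h5 : R * (1 - 2 * (r ^ 2 / R ^ 2)) ≤ R * bump R (v - u) := by gcongr
    have h6 : 2 * R - 2 * r ^ 2 ≤ R + R * bump R (v - u) := by nlinarith
    nlinarith [mul_le_mul_of_nonneg_left h6 hc0.le]
  · simp only [hlap]
    have h1 := sum_abs_laplacian_bump_mul_le hR1 hR1 u F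
    calc ∑ x ∈ F, (c * R * laplacian (bump R) (x - u)) ^ 2
        = (c * R) ^ 2 * ∑ x ∈ F, |laplacian (bump R) (x - u)| * |laplacian (bump R) (x - u)| := by
          rw [Finset.mul_sum]
          exact Finset.sum_congr rfl fun x _ => by rw [abs_mul_abs_self]; ring
      _ ≤ (c * R) ^ 2 * ((5 * R) ^ 3 * ((3 : ℕ) * (34 / R ^ 2) * ((3 : ℕ) * (34 / R ^ 2)))) := by
          gcongr
      _ = c * (c * B) * R := by rw [hB]; push_cast; field_simp; norm_num
      _ = 4 * c * R := by rw [hc, div_mul_cancel₀ _ hB0.ne']; ring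
      _ ≤ _ := by linarith [mul_nonneg hc0.le (mul_nonneg zero_le_two (sq_nonneg r))]

/-! ### Dyadic test functions in four dimensions -/

theorem sum_range_pow_four_le (K : ℕ) : ∑ j ∈ Finset.range K, (4 : ℝ) ^ j ≤ 4 ^ K / 2 := by
  induction K with
  | zero => norm_num
  | succ K ih =>
    rw [Finset.sum_range_succ, pow_succ]
    have : (0 : ℝ) < 4 ^ K := by positivity
    linarith

theorem sum_range_inv_pow_four_le (K : ℕ) : ∑ j ∈ Finset.range K, 1 / (4 : ℝ) ^ j ≤ 2 := by
  -- The subtracted tail of the geometric series makes the induction close.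
  have h : ∀ K : ℕ, ∑ j ∈ Finset.range K, 1 / (4 : ℝ) ^ j ≤ 2 - 4 / 3 * (1 / 4 ^ K) := by
    intro K
    induction K with
    | zero => norm_num
    | succ K ih =>
      rw [Finset.sum_range_succ, pow_succ]
      have : (0 : ℝ) < 1 / 4 ^ K := by positivity
      have e : 1 / ((4 : ℝ) ^ K * 4) = 1 / 4 ^ K / 4 := by field_simp
      rw [e]
      linarith
  have : (0 : ℝ) < 1 / 4 ^ K := by positivity
  linarith [h K]

/-- The energy of a sum of bumps at dyadic scales in four dimensions is at most proportional to the
number of scales. -/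
theorem sum_sq_sum_laplacian_dyadic_le (w : Site 4) (F : Finset (Site 4)) (K : ℕ) :
    ∑ x ∈ F, (∑ k ∈ Finset.range K, laplacian (bump (2 ^ k)) (x - w)) ^ 2 ≤
      2 * (625 * 136 ^ 2) * K := by
  have hp : ∀ k : ℕ, (1 : ℝ) ≤ 2 ^ k := fun k => one_le_pow₀ one_le_two
  have h4 : ∀ k : ℕ, ((2 : ℝ) ^ k) ^ 2 = 4 ^ k := fun k => by
    rw [← pow_mul, mul_comm, pow_mul]; norm_num
  have hpair : ∀ j k : ℕ, ∑ x ∈ F, |laplacian (bump (2 ^ j)) (x - w)| *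
      |laplacian (bump (2 ^ k)) (x - w)| ≤ 625 * 136 ^ 2 * (4 ^ j / 4 ^ k) := by
    intro j k
    refine (sum_abs_laplacian_bump_mul_le (hp j) (hp k) w F).trans (le_of_eq ?_)
    rw [mul_pow, h4, h4, show ((2 : ℝ) ^ j) ^ 4 = 4 ^ j * 4 ^ j by rw [← h4]; ring]
    push_cast
    field_simp
    norm_num
  induction K with
  | zero => simp
  | succ K ih =>
    -- The overlaps of the new scale with all finer ones sum geometrically. Each scale therefore
    -- costs twice this bound plus its self-energy, `2 · 625 · 136²` in total.
    have hcross : ∑ x ∈ F, (∑ k ∈ Finset.range K, laplacian (bump (2 ^ k)) (x - w)) *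
        laplacian (bump (2 ^ K)) (x - w) ≤ 625 * 136 ^ 2 * (1 / 2) := by
      calc _ ≤ ∑ x ∈ F, ∑ k ∈ Finset.range K, |laplacian (bump (2 ^ k)) (x - w)| *
            |laplacian (bump (2 ^ K)) (x - w)| := by
            refine Finset.sum_le_sum fun x _ => ?_
            rw [Finset.sum_mul]
            exact Finset.sum_le_sum fun k _ => (le_abs_self _).trans (abs_mul _ _).le
        _ ≤ ∑ k ∈ Finset.range K, 625 * 136 ^ 2 * ((4 : ℝ) ^ k / 4 ^ K) := by
            rw [Finset.sum_comm]
            exact Finset.sum_le_sum fun k _ => hpair k K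
        _ ≤ _ := by
            rw [← Finset.mul_sum, ← Finset.sum_div]
            refine mul_le_mul_of_nonneg_left ?_ (by norm_num)
            rw [div_le_iff₀ (by positivity)]
            linarith [sum_range_pow_four_le K]
    have hself := hpair K K
    rw [div_self (by positivity)] at hself
    have e : ∀ x, (∑ k ∈ Finset.range (K + 1), laplacian (bump (2 ^ k)) (x - w)) ^ 2 =
        (∑ k ∈ Finset.range K, laplacian (bump (2 ^ k)) (x - w)) ^ 2 +
        2 * ((∑ k ∈ Finset.range K, laplacian (bump (2 ^ k)) (x - w)) *
          laplacian (bump (2 ^ K)) (x - w)) +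
        |laplacian (bump (2 ^ K)) (x - w)| * |laplacian (bump (2 ^ K)) (x - w)| := fun x => by
      rw [Finset.sum_range_succ, abs_mul_abs_self]; ring
    simp only [e, Finset.sum_add_distrib, ← Finset.mul_sum]
    push_cast
    linarith

theorem hasTestFunctions_four : ∃ J : ℝ, 0 < J ∧ ∃ c : ℝ, 0 < c ∧
    HasTestFunctions 4 Real.log J c := by
  obtain ⟨B, hB⟩ : ∃ B : ℝ, B = 625 * 136 ^ 2 := ⟨_, rfl⟩
  have hB0 : 0 < B := by rw [hB]; norm_num
  refine ⟨272 * (1 / B), by positivity, 1 / B, by positivity, fun r => ?_⟩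
  set c := 1 / B with hc
  have hc0 : 0 < c := by positivity
  -- The losses `2r²/4^k` at `v` sum to at most `4r²`; the `2` absorbs rounding `log |u|` to a
  -- number of scales.
  refine ⟨c * (4 * r ^ 2 + 2), max 1 r, fun u v huv hu => ?_⟩
  have hu1 : 1 ≤ siteNorm u := (le_max_left _ _).trans hu
  have hp : ∀ k : ℕ, (1 : ℝ) ≤ 2 ^ k := fun k => one_le_pow₀ one_le_two
  have hp0 : ∀ k : ℕ, (0 : ℝ) < 2 ^ k := fun k => by positivity
  have h4 : ∀ k : ℕ, ((2 : ℝ) ^ k) ^ 2 = 4 ^ k := fun k => by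
    rw [← pow_mul, mul_comm, pow_mul]; norm_num
  -- The scales are `2^0, …, 2^n ≤ |u|`. As `1/2 < log 2 < 1`, their number `n + 1` is at least `log
  -- |u|` (charge) and at most `2 log |u| + 1` (energy).
  obtain ⟨n, hn1, hn2⟩ := exists_nat_pow_near hu1 one_lt_two
  have hlog1 : Real.log (siteNorm u) ≤ (n + 1 : ℕ) := by
    have := Real.log_le_log (by linarith) hn2.le
    rw [Real.log_pow] at this
    refine this.trans (mul_le_of_le_one_right (Nat.cast_nonneg _) ?_)
    linarith [Real.log_two_lt_d9]
  have hlog2 : (n : ℝ) ≤ 2 * Real.log (siteNorm u) := by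
    have := Real.log_le_log (hp0 n) hn1
    rw [Real.log_pow] at this
    have h2 := Real.log_two_gt_d9
    have h3 : (n : ℝ) * (1 / 2) ≤ n * Real.log 2 := by gcongr; linarith
    linarith
  have hlap : ∀ x, laplacian (fun x => c * ∑ k ∈ Finset.range (n + 1), bump (2 ^ k) (x - u)) x =
      c * ∑ k ∈ Finset.range (n + 1), laplacian (bump (2 ^ k)) (x - u) := fun x => by
    rw [laplacian_const_mul, laplacian_sum]
    simp only [laplacian_comp_sub]
  refine ⟨fun x => c * ∑ k ∈ Finset.range (n + 1), bump (2 ^ k) (x - u),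
    ⟨∑ j, (u j).natAbs + ⌈(2 : ℝ) ^ n⌉₊, fun x hx i => ?_⟩, fun x => ?_, ?_, fun F => ?_⟩
  · obtain ⟨k, hk, hne⟩ := Finset.exists_ne_zero_of_sum_ne_zero (right_ne_zero_of_mul hx)
    refine (abs_le_of_bump_sub_ne_zero (hp0 k) hne i).trans ?_
    have : ⌈(2 : ℝ) ^ k⌉₊ ≤ ⌈(2 : ℝ) ^ n⌉₊ := Nat.ceil_mono
      (pow_le_pow_right₀ one_le_two (Nat.lt_succ_iff.1 (Finset.mem_range.1 hk)))
    exact_mod_cast Nat.add_le_add_left this _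
  · rw [hlap, abs_mul, abs_of_pos hc0]
    calc _ ≤ c * ∑ k ∈ Finset.range (n + 1), (136 : ℝ) * (1 / 4 ^ k) := by
          gcongr
          refine (Finset.abs_sum_le_sum_abs _ _).trans (Finset.sum_le_sum fun k _ =>
            (abs_laplacian_bump_le (hp k) _).trans (le_of_eq ?_))
          rw [h4]; push_cast; ring
      _ ≤ c * (136 * 2) := by
          rw [← Finset.mul_sum]
          gcongr
          exact sum_range_inv_pow_four_le _
      _ = _ := by ring
  · have hz : ∀ k ∈ Finset.range (n + 1), bump (2 ^ k) (-v - u) = 0 ∧ bump (2 ^ k) (-u - u) = 0 :=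
      fun k hk => bump_neg_sub_eq_zero (hp0 k) huv ((pow_le_pow_right₀ one_le_two
        (Nat.lt_succ_iff.1 (Finset.mem_range.1 hk))).trans hn1) ((le_max_right _ _).trans hu)
    have e1 : ∑ k ∈ Finset.range (n + 1), bump (2 ^ k) (-v - u) = 0 :=
      Finset.sum_eq_zero fun k hk => (hz k hk).1
    have e2 : ∑ k ∈ Finset.range (n + 1), bump (2 ^ k) (-u - u) = 0 :=
      Finset.sum_eq_zero fun k hk => (hz k hk).2
    have e3 : (n + 1 : ℕ) - 4 * r ^ 2 ≤ ∑ k ∈ Finset.range (n + 1), bump (2 ^ k) (v - u) := by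
      calc ((n + 1 : ℕ) - 4 * r ^ 2 : ℝ) ≤
            (n + 1 : ℕ) - 2 * r ^ 2 * ∑ k ∈ Finset.range (n + 1), 1 / (4 : ℝ) ^ k := by
            have := mul_le_mul_of_nonneg_left (sum_range_inv_pow_four_le (n + 1))
              (mul_nonneg zero_le_two (sq_nonneg r))
            linarith
        _ = ∑ k ∈ Finset.range (n + 1), (1 - 2 * (r ^ 2 / (2 ^ k) ^ 2)) := by
            rw [Finset.sum_sub_distrib, Finset.mul_sum]
            congr 1
            · simp
            · exact Finset.sum_congr rfl fun k _ => by rw [h4]; ring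
        _ ≤ _ := Finset.sum_le_sum fun k _ => one_sub_le_bump_sub (hp0 k) huv
    simp only [pairCharge, e1, e2, sub_self, bump_zero, Finset.sum_const, Finset.card_range,
      nsmul_eq_mul, mul_one, mul_zero, sub_zero]
    have h6 : 2 * Real.log (siteNorm u) - (4 * r ^ 2 + 2) ≤
        (n + 1 : ℕ) + ∑ k ∈ Finset.range (n + 1), bump (2 ^ k) (v - u) := by linarith
    have := mul_le_mul_of_nonneg_left h6 hc0.le
    linarith
  · simp only [hlap, mul_pow, ← Finset.mul_sum]
    have h1 := sum_sq_sum_laplacian_dyadic_le u F (n + 1)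
    rw [← hB] at h1
    have h2 : c ^ 2 * (2 * B * (n + 1 : ℕ)) = c * (2 * (n + 1)) := by
      rw [hc]; push_cast; field_simp
    have h3 := mul_le_mul_of_nonneg_left h1 (sq_nonneg c)
    rw [h2] at h3
    have h5 : 2 * ((n : ℝ) + 1) ≤ 4 * Real.log (siteNorm u) + (4 * r ^ 2 + 2) := by
      nlinarith [sq_nonneg r]
    have := mul_le_mul_of_nonneg_left h5 hc0.le
    linarith

/-! ### The decay rate -/

theorem half_sq_le_cosh_sub_one_div {J q : ℝ} (hJ : 0 < J) (hq : 0 ≤ q) :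
    q ^ 2 / 2 ≤ (Real.cosh (q * J) - 1) / J ^ 2 := by
  rw [le_div_iff₀ (by positivity)]
  have h : 0 ≤ q * J / 2 := by positivity
  have := pow_le_pow_left₀ h (Real.self_le_sinh_iff.2 h) 2
  rw [cosh_sub_one_eq]
  nlinarith

/-- The function under the supremum is at most `q - sq²`, hence negative beyond `1/s`, so a maximum
over `[0, 1/s]` suffices. Allowing `q = 0` is harmless. -/
theorem exists_decayRate_le {J s : ℝ} (hJ : 0 < J) (hs : 0 < s) :
    ∃ q : ℝ, 0 ≤ q ∧
      decayRate J s ≤ 2 * (q - 2 * s * ((Real.cosh (q * J) - 1) / J ^ 2)) := by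
  set h : ℝ → ℝ := fun q => q - 2 * s * ((Real.cosh (q * J) - 1) / J ^ 2) with hh
  have hc : Continuous h := by fun_prop
  have h1s : 0 < 1 / s := by positivity
  obtain ⟨q₀, hq₀, hmax⟩ := isCompact_Icc.exists_isMaxOn (Set.nonempty_Icc.2 h1s.le)
    hc.continuousOn
  refine ⟨q₀, hq₀.1, mul_le_mul_of_nonneg_left (csSup_le (Set.nonempty_Ioi.image _) ?_)
    zero_le_two⟩
  rintro _ ⟨q, hq, rfl⟩
  rcases le_or_gt q (1 / s) with hqs | hqs
  · exact hmax ⟨le_of_lt hq, hqs⟩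
  · have h0 : h 0 ≤ h q₀ := hmax ⟨le_rfl, h1s.le⟩
    have h00 : h 0 = 0 := by simp [hh]
    refine le_trans ?_ (h00 ▸ h0)
    have h2 := mul_le_mul_of_nonneg_left (half_sq_le_cosh_sub_one_div hJ (le_of_lt hq))
      (mul_pos two_pos hs).le
    have hq0 : 0 < q := hq
    have h3 : 1 < q * s := (div_lt_iff₀ hs).1 hqs
    show q - 2 * s * ((Real.cosh (q * J) - 1) / J ^ 2) ≤ 0
    nlinarith

theorem isEquivalent_decayRate {J : ℝ} (hJ : 0 < J) :
    decayRate J ~[atTop] fun s : ℝ => 1 / (2 * s) := by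
  refine isEquivalent_of_tendsto_one ?_
  have hlow : Tendsto (fun s : ℝ => 1 - J ^ 2 / (8 * s ^ 2)) atTop (𝓝 1) := by
    have h : Tendsto (fun s : ℝ => J ^ 2 / (8 * s ^ 2)) atTop (𝓝 0) :=
      tendsto_const_nhds.div_atTop
        (Tendsto.const_mul_atTop (by norm_num) (tendsto_pow_atTop two_ne_zero))
    simpa using h.const_sub 1
  refine tendsto_of_tendsto_of_tendsto_of_le_of_le' hlow tendsto_const_nhds ?_ ?_
  · filter_upwards [eventually_ge_atTop (max 1 J)] with s hs
    have hs1 : 1 ≤ s := (le_max_left _ _).trans hs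
    have hsJ : J ≤ s := (le_max_right _ _).trans hs
    have hs0 : 0 < s := by linarith
    -- The trial value is `q = 1/(2s)`, the maximiser of `q - sq²`. Here `y = (qJ)²/2`, and `cosh x
    -- ≤ exp(x²/2)` bounds the deviation from the quadratic case.
    set y := J ^ 2 / (8 * s ^ 2) with hy
    have hy0 : 0 < y := by positivity
    have hy1 : y ≤ 1 := by
      rw [hy, div_le_one (by positivity)]
      nlinarith
    have hexp : Real.cosh (1 / (2 * s) * J) - 1 ≤ y + y ^ 2 := by
      have h1 := Real.cosh_le_exp_half_sq (1 / (2 * s) * J)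
      have e : (1 / (2 * s) * J) ^ 2 / 2 = y := by rw [hy]; field_simp; norm_num
      rw [e] at h1
      have h2 := (abs_le.1 (Real.abs_exp_sub_one_sub_id_le (x := y)
        (by rwa [abs_of_pos hy0]))).2
      linarith
    have hsup : 1 / (2 * s) - 2 * s * ((Real.cosh (1 / (2 * s) * J) - 1) / J ^ 2) ≤
        sSup ((fun q : ℝ => q - 2 * s * ((Real.cosh (q * J) - 1) / J ^ 2)) '' Set.Ioi 0) :=
      le_csSup (decayRate_bddAbove hJ hs0) ⟨1 / (2 * s), by
        rw [Set.mem_Ioi]; positivity, rfl⟩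
    have hk : 2 * s * ((Real.cosh (1 / (2 * s) * J) - 1) / J ^ 2) ≤
        2 * s * ((y + y ^ 2) / J ^ 2) := by gcongr
    have hyJ : 2 * s * ((y + y ^ 2) / J ^ 2) = (1 + y) / (4 * s) := by
      have : (y + y ^ 2) / J ^ 2 = y / J ^ 2 * (1 + y) := by ring
      rw [this, show y / J ^ 2 = 1 / (8 * s ^ 2) by rw [hy]; field_simp]
      field_simp
      norm_num
    rw [Pi.div_apply, div_div_eq_mul_div, div_one, decayRate]
    have h5 : 1 / (2 * s) - (1 + y) / (4 * s) = (1 - y) / (4 * s) := by field_simp; ring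
    have h6 : (1 - y) / (4 * s) ≤
        sSup ((fun q : ℝ => q - 2 * s * ((Real.cosh (q * J) - 1) / J ^ 2)) '' Set.Ioi 0) := by
      linarith
    rw [div_le_iff₀ (by positivity)] at h6
    linarith
  · filter_upwards [eventually_gt_atTop 0] with s hs
    rw [Pi.div_apply, div_div_eq_mul_div, div_one]
    obtain ⟨q, hq, h⟩ := exists_decayRate_le hJ hs
    have h1 := mul_le_mul_of_nonneg_left (half_sq_le_cosh_sub_one_div hJ hq)
      (mul_pos two_pos hs).le
    have h2 : decayRate J s ≤ 2 * (q - s * q ^ 2) := by linarith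
    have h3 := mul_le_mul_of_nonneg_right h2 (mul_pos two_pos hs).le
    nlinarith [sq_nonneg (2 * s * q - 1)]

/-! ### Decay of the Cooper-pair correlation -/

theorem norm_le_of_mapClusterPt {w : ℕ → ℂ} {ℓ : ℂ} (h : MapClusterPt ℓ atTop w) {b : ℝ}
    (hb : ∀ᶠ n in atTop, ‖w n‖ ≤ b) : ‖ℓ‖ ≤ b := by
  by_contra hlt
  push Not at hlt
  have hev : ∀ᶠ z in 𝓝 ℓ, b < ‖z‖ := continuous_norm.continuousAt.eventually_const_lt hlt
  obtain ⟨n, h1, h2⟩ := ((h.frequently hev).and_eventually hb).exists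
  linarith

theorem norm_cooperCorrelation_le_one {D L : ℕ} (M : ElectronModel D) {β α : ℝ} (hβ : 0 < β)
    (hα : 0 < α) (μ κ : ℝ) (u v : Site D) : ‖cooperCorrelation M L β μ κ α u v‖ ≤ 1 := by
  have := norm_cooperCorrelation_le (L := L) M hβ hα μ κ 0 u v 0
  simpa [pairCharge] using this

/-- Since `q` depends only on `J` and `β/α`, the errors in charge and energy cost a constant factor
uniform in the model and the sites. -/
theorem exists_bound_of_hasTestFunctions {D : ℕ} {g : ℝ → ℝ} {J c : ℝ} (hJ : 0 < J) (hc : 0 < c)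
    (hg0 : ∀ u : Site D, 0 ≤ g (siteNorm u)) (hg : ∀ u : Site D, g (siteNorm u) ≤ siteNorm u)
    (h : HasTestFunctions D g J c) {β α : ℝ} (hβ : 0 < β) (hα : 0 < α) (r : ℝ) :
    ∃ C : ℝ, ∀ (M : ElectronModel D) (μ κ : ℝ), ∀ u v : Site D, siteNorm (u - v) ≤ r →
      ∀ ℓ : ℂ, MapClusterPt ℓ atTop (fun L : ℕ => cooperCorrelation M L β μ κ α u v) →
        ‖ℓ‖ ≤ C * Real.exp (-(c * decayRate J (β / α) * g (siteNorm u))) := by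
  obtain ⟨C₁, R₀, hT⟩ := h r
  have hs : 0 < β / α := div_pos hβ hα
  set s := β / α with hsdef
  obtain ⟨q, hq, hf⟩ := exists_decayRate_le hJ hs
  set f := decayRate J s
  set k := (Real.cosh (q * J) - 1) / J ^ 2 with hk
  have hk0 : 0 ≤ k := div_nonneg (by linarith [Real.one_le_cosh (q * J)]) (sq_nonneg J)
  -- The first summand serves `|u| ≥ R₀`; the second compensates the exponential for small `|u|`,
  -- where the trivial bound `1` is used.
  refine ⟨Real.exp (q * C₁ + s * k * C₁) + Real.exp (c * |f| * |R₀|), fun M μ κ u v huv ℓ hℓ => ?_⟩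
  rw [add_mul, ← Real.exp_add, ← Real.exp_add]
  set G := g (siteNorm u)
  have hG0 : 0 ≤ G := hg0 u
  rcases le_or_gt R₀ (siteNorm u) with hu | hu
  · obtain ⟨θ, ⟨N, hN⟩, hθJ, hΘ, hE⟩ := hT u v huv hu
    refine le_add_of_le_of_nonneg ?_ (Real.exp_pos _).le
    refine norm_le_of_mapClusterPt hℓ ?_
    filter_upwards [eventually_ge_atTop (N + 1)] with L hL
    refine (norm_cooperCorrelation_le M hβ hα μ κ θ u v q).trans (Real.exp_le_exp.2 ?_)
    have hsupp : ∀ x, θ x ≠ 0 → ∀ i, |x i| + 1 ≤ (L : ℤ) := fun x hx i => by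
      have := hN x hx i
      have : ((N + 1 : ℕ) : ℤ) ≤ L := by exact_mod_cast hL
      push_cast at this
      linarith
    have hsum : ∑ x ∈ box D L, (Real.cosh (q * divergence (grad L θ) x) - 1) ≤
        k * (4 * c * G + C₁) := by
      calc _ ≤ ∑ x ∈ box D L, laplacian θ x ^ 2 * k := by
            refine Finset.sum_le_sum fun x _ => ?_
            rw [divergence_grad hsupp, mul_neg, Real.cosh_neg]
            exact cosh_mul_sub_one_le hq hJ (hθJ x)
        _ = k * ∑ x ∈ box D L, laplacian θ x ^ 2 := by rw [← Finset.sum_mul, mul_comm]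
        _ ≤ _ := mul_le_mul_of_nonneg_left (hE _) hk0
    -- The exponent is at most `-q(2cG - C₁) + sk(4cG + C₁)`, that is, `-2cG(q - 2sk) + (q + sk)C₁`,
    -- and `f ≤ 2(q - 2sk)`.
    have h1 := mul_le_mul_of_nonneg_left hsum hs.le
    have h2 := mul_le_mul_of_nonneg_left hΘ hq
    have h3 := mul_le_mul_of_nonneg_left hf (mul_nonneg hc.le hG0)
    linarith
  · refine le_add_of_nonneg_of_le (Real.exp_pos _).le ?_
    refine (norm_le_of_mapClusterPt hℓ (Eventually.of_forall fun L =>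
      norm_cooperCorrelation_le_one M hβ hα μ κ u v)).trans (Real.one_le_exp ?_)
    have h1 : G ≤ |R₀| := (hg u).trans (hu.le.trans (le_abs_self _))
    have h2 : f * G ≤ |f| * |R₀| := mul_le_mul (le_abs_self f) h1 hG0 (abs_nonneg f)
    nlinarith

/-- `|u|²` is a nonnegative integer, and the convention `log 0 = 0` covers the origin. -/
theorem log_siteNorm_nonneg {D : ℕ} (u : Site D) : 0 ≤ Real.log (siteNorm u) := by
  have e : (∑ i, (u i : ℝ) ^ 2) = ((∑ i, u i ^ 2 : ℤ) : ℝ) := by push_cast; rfl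
  rw [siteNorm, Real.log_sqrt (Finset.sum_nonneg fun _ _ => sq_nonneg _), e]
  have := Real.log_intCast_nonneg (∑ i, u i ^ 2)
  linarith

end GaugedElectrons
end

open GaugedElectrons
theorem theorem1 (D : ℕ) (hD : D = 3 ∨ D = 4) :
    ∃ J : ℝ, 0 < J ∧ ∃ c : ℝ, 0 < c ∧
      (decayRate J ~[atTop] fun s : ℝ => 1 / (2 * s)) ∧
      ∀ (β α : ℝ), 0 < β → 0 < α → ∀ r : ℝ, ∃ C : ℝ,
        ∀ (M : ElectronModel D) (μ κ : ℝ), 0 < κ →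
        ∀ u v : Site D, siteNorm (u - v) ≤ r →
        ∀ ℓ : ℂ, MapClusterPt ℓ atTop (fun L : ℕ => cooperCorrelation M L β μ κ α u v) →
          (D = 3 → ‖ℓ‖ ≤ C * Real.exp (-(c * decayRate J (β / α) * siteNorm u))) ∧
          (D = 4 → u ≠ 0 →
            ‖ℓ‖ ≤ C * Real.exp (-(c * decayRate J (β / α) * Real.log (siteNorm u)))) := by
  rcases hD with rfl | rfl
  · obtain ⟨J, hJ, c, hc, h⟩ := hasTestFunctions_three
    refine ⟨J, hJ, c, hc, isEquivalent_decayRate hJ, fun β α hβ hα r => ?_⟩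
    obtain ⟨C, hC⟩ := exists_bound_of_hasTestFunctions hJ hc siteNorm_nonneg (fun _ => le_rfl) h
      hβ hα r
    exact ⟨C, fun M μ κ _ u v huv ℓ hℓ =>
      ⟨fun _ => hC M μ κ u v huv ℓ hℓ, fun h => absurd h (by norm_num)⟩⟩
  · obtain ⟨J, hJ, c, hc, h⟩ := hasTestFunctions_four
    refine ⟨J, hJ, c, hc, isEquivalent_decayRate hJ, fun β α hβ hα r => ?_⟩
    obtain ⟨C, hC⟩ := exists_bound_of_hasTestFunctions hJ hc log_siteNorm_nonneg
      (fun u => Real.log_le_self (siteNorm_nonneg u)) h hβ hα r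
    exact ⟨C, fun M μ κ _ u v huv ℓ hℓ =>
      ⟨fun h => absurd h (by norm_num), fun _ _ => hC M μ κ u v huv ℓ hℓ⟩⟩
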